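/- Let $d\ge 2$ and $r\ge 1$ be integers and let $P_k^+,P_k^-\in\mathbb R^{r\times r}$ ($k\in\mathbb Z$). Let $\phi:\mathbb R\to\mathbb C^r$ (or $\mathbb R\to\mathbb R^r$) be a two-direction multiscaling function with these coefficients, that is, $$\phi(x)=\sqrt d\sum_{k\in\mathbb Z}\bigl[P_k^+\phi(dx-k)+P_k^-\phi(k-dx)\bigr]\qquad(x\in\mathbb R),$$ and $\phi$ generates a multiresolution approximation of $L^2(\mathbb R)$: the closed spans $V_n$ ($n\in\mathbb Z$) of the functions $\phi_i(d^nx-k)$, $\phi_i(k-d^nx)$, $1\le i\le r$, $k\in\mathbb Z$, are nested ($V_n\subset V_{n+1}$), have dense union and trivial intersection, $f\in V_n\iff f(d\,\cdot)\in V_{n+1}$, $V_0$ is invariant under integer translations, and the functions $\phi_i(x-k)$, $\phi_i(k-x)$ form a Riesz basis of $V_0$. Assume that $\phi$ is continuous, has compact support, is orthogonal, that is, $$\int\phi(x-j)\phi(x-k)^*\,dx=\delta_{jk}I_r,\qquad \int\phi(x-j)\phi(k-x)^*\,dx=0\qquad(j,k\in\mathbb Z),$$ and satisfies Condition E: the matrix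 $$\frac1{\sqrt d}\sum_{k\in\mathbb Z}\begin{bmatrix}P_k^+&P_k^-\\P_{-k}^-&P_{-k}^+\end{bmatrix}$$ has $1$ as an eigenvalue of algebraic multiplicity one, and all its other eigenvalues are smaller than $1$ in absolute value. For $s=1,\dots,d-1$ let $Q_k^{(s)+},Q_k^{(s)-}\in\mathbb R^{r\times r}$ ($k\in\mathbb Z$) and $$\psi^{(s)}(x)=\sqrt d\sum_{k\in\mathbb Z}\bigl[Q_k^{(s)+}\phi(dx-k)+Q_k^{(s)-}\phi(k-dx)\bigr]\qquad(x\in\mathbb R).$$ Define the discrete moments $M_j^\pm=\frac1{\sqrt d}\sum_kk^jP_k^\pm$, $M_j=M_j^++M_j^-$, $N_j^{(s)\pm}=\frac1{\sqrt d}\sum_kk^jQ_k^{(s)\pm}$ and the continuous moments $\mathbf m_j=\int x^j\phi(x)\,dx$, $\mathbf n_j^{(s)}=\int x^j\psi^{(s)}(x)\,dx$, $j=0,1,2,\dots$. Then only finitely many $P_k^\pm$ are nonzero, all $x^j\phi$ are integrable, and the following hold. (a) $M_0\mathbf m_0=\mathbf m_0$ and $\mathbf m_0^*\mathbf m_0=\tfrac12$;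 these two conditions determine $\mathbf m_0$ up to a scalar factor of absolute value $1$. (b) For every $j\ge1$ the matrix $d^jI_r-[M_0^++(-1)^jM_0^-]$ is nonsingular and $$\mathbf m_j=\bigl(d^jI_r-[M_0^++(-1)^jM_0^-]\bigr)^{-1}\sum_{\ell=0}^{j-1}\binom j\ell\bigl[M_{j-\ell}^++(-1)^\ell M_{j-\ell}^-\bigr]\mathbf m_\ell .$$ (c) The sequence $(\mathbf m_j)_{j\ge0}$ is the only sequence of vectors that starts with $\mathbf m_0$ and satisfies the recursion in (b). (d) For all $s$ and all $j\ge0$ for which $x^j\psi^{(s)}$ is integrable (all $j$ if $\psi^{(s)}$ has compact support), the series defining $N_i^{(s)\pm}$, $0\le i\le j$, converge absolutely and $$\mathbf n_j^{(s)}=d^{-j}\sum_{\ell=0}^{j}\binom j\ell\bigl[N_{j-\ell}^{(s)+}+(-1)^\ell N_{j-\ell}^{(s)-}\bigr]\mathbf m_\ell .$$ -/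

import Mathlib

open MeasureTheory

namespace TwoDirection

noncomputable section

/-- A real matrix acting on a vector with entries in `𝕜` (`ℝ` or `ℂ`). -/
def act {𝕜 : Type*} [RCLike 𝕜] {r : ℕ} (A : Matrix (Fin r) (Fin r) ℝ) (v : Fin r → 𝕜) :
    Fin r → 𝕜 :=
  (A.map (algebraMap ℝ 𝕜)).mulVec v

/-- The two-direction relation
`f(x) = √d ∑_{k ∈ ℤ} [C⁺_k φ(d x - k) + C⁻_k φ(k - d x)]` for all real `x`.
With `f = φ` it is the two-direction refinement equation of `φ`; with `f = ψ⁽ˢ⁾` it is the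
relation that defines the two-direction multiwavelets associated with `φ`. -/
def Recursion {𝕜 : Type*} [RCLike 𝕜] {r : ℕ} (d : ℕ) (Cp Cm : ℤ → Matrix (Fin r) (Fin r) ℝ)
    (φ f : ℝ → Fin r → 𝕜) : Prop :=
  ∀ x : ℝ, HasSum
    (fun k : ℤ => Real.sqrt d • (act (Cp k) (φ (d * x - k)) + act (Cm k) (φ (k - d * x)))) (f x)

/-- The functions `φ_i(dⁿ x - k)` (tag `true`) and `φ_i(k - dⁿ x)` (tag `false`). -/
def shift {𝕜 : Type*} [RCLike 𝕜] {r : ℕ} (d : ℕ) (φ : ℝ → Fin r → 𝕜) (n : ℤ)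
    (p : Fin r × ℤ × Bool) : ℝ → 𝕜 := fun x =>
  if p.2.2 then φ ((d : ℝ) ^ n * x - p.2.1) p.1 else φ (p.2.1 - (d : ℝ) ^ n * x) p.1

/-- `V_n`: the closed linear span in `L²(ℝ)` of the functions
`φ_i(dⁿ x - k)` and `φ_i(k - dⁿ x)`, for all `i` and all integers `k`. -/
def scaleSpace {𝕜 : Type*} [RCLike 𝕜] {r : ℕ} (d : ℕ) (φ : ℝ → Fin r → 𝕜) (n : ℤ) :
    Submodule 𝕜 (Lp 𝕜 2 (volume : Measure ℝ)) :=
  (Submodule.span 𝕜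
    {f : Lp 𝕜 2 (volume : Measure ℝ) | ∃ p, f =ᵐ[volume] shift d φ n p}).topologicalClosure

/-- A multiresolution approximation of `L²(ℝ)` with dilation factor `d`. -/
structure IsMRA {𝕜 : Type*} [RCLike 𝕜] (d : ℕ)
    (V : ℤ → Submodule 𝕜 (Lp 𝕜 2 (volume : Measure ℝ))) : Prop where
  closed : ∀ n, IsClosed (V n : Set (Lp 𝕜 2 (volume : Measure ℝ)))
  nested : ∀ n, V n ≤ V (n + 1)
  dense : (⨆ n, V n).topologicalClosure = ⊤
  separated : ⨅ n, V n = ⊥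
  dilation : ∀ (n : ℤ) (f g : Lp 𝕜 2 (volume : Measure ℝ)),
    (g =ᵐ[volume] fun x => f (d * x)) → (f ∈ V n ↔ g ∈ V (n + 1))
  translation : ∀ (k : ℤ) (f g : Lp 𝕜 2 (volume : Measure ℝ)),
    (g =ᵐ[volume] fun x => f (x - k)) → f ∈ V 0 → g ∈ V 0

/-- `φ` generates a multiresolution approximation: the spaces `V_n` form one, and the functions
`φ_i(x - k)`, `φ_i(k - x)` are a stable (Riesz) basis of `V_0`. -/
def GeneratesMRA {𝕜 : Type*} [RCLike 𝕜] {r : ℕ} (d : ℕ) (φ : ℝ → Fin r → 𝕜) : Prop :=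
  IsMRA d (scaleSpace d φ) ∧
    (∀ p, MemLp (shift d φ 0 p) 2 volume) ∧
    ∃ A B : ℝ, 0 < A ∧ ∀ c : (Fin r × ℤ × Bool) →₀ 𝕜,
      A * ∑ p ∈ c.support, ‖c p‖ ^ 2 ≤ ∫ x, ‖∑ p ∈ c.support, c p * shift d φ 0 p x‖ ^ 2 ∧
      ∫ x, ‖∑ p ∈ c.support, c p * shift d φ 0 p x‖ ^ 2 ≤ B * ∑ p ∈ c.support, ‖c p‖ ^ 2

/-- A two-direction multiscaling function of multiplicity `r` and dilation factor `d` with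
recursion coefficients `P⁺_k`, `P⁻_k`. -/
structure IsMultiscaling {𝕜 : Type*} [RCLike 𝕜] {r : ℕ} (d : ℕ)
    (Pp Pm : ℤ → Matrix (Fin r) (Fin r) ℝ) (φ : ℝ → Fin r → 𝕜) : Prop where
  recursion : Recursion d Pp Pm φ φ
  mra : GeneratesMRA d φ

/-- The matrix-valued inner product `⟨f, g⟩ = ∫ f(x) g(x)^* dx`. -/
def gram {𝕜 : Type*} [RCLike 𝕜] {r : ℕ} (f g : ℝ → Fin r → 𝕜) : Matrix (Fin r) (Fin r) 𝕜 :=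
  Matrix.of fun a b => ∫ x, f x a * star (g x b)

/-- Orthogonality of `φ`: `⟨φ(x-j), φ(x-k)⟩ = δ_{jk} I_r` and `⟨φ(x-j), φ(k-x)⟩ = O`. -/
def Orthogonal {𝕜 : Type*} [RCLike 𝕜] {r : ℕ} (φ : ℝ → Fin r → 𝕜) : Prop :=
  ∀ j k : ℤ,
    gram (fun x => φ (x - j)) (fun x => φ (x - k)) = (if j = k then 1 else 0) ∧
    gram (fun x => φ (x - j)) (fun x => φ (k - x)) = 0

/-- Condition E for a square matrix: `1` is an eigenvalue of algebraic multiplicity one and all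
other complex eigenvalues are smaller than `1` in absolute value. -/
def ConditionE {ι : Type*} [Fintype ι] [DecidableEq ι] (A : Matrix ι ι ℂ) : Prop :=
  A.charpoly.rootMultiplicity 1 = 1 ∧ ∀ μ ∈ spectrum ℂ A, μ ≠ 1 → ‖μ‖ < 1

/-- The matrix `(1/√d) ∑_k [[P⁺_k, P⁻_k], [P⁻_{-k}, P⁺_{-k}]]`. -/
def doubledMask {r : ℕ} (d : ℕ) (Pp Pm : ℤ → Matrix (Fin r) (Fin r) ℝ) :
    Matrix (Fin r ⊕ Fin r) (Fin r ⊕ Fin r) ℝ :=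
  (1 / Real.sqrt d) • ∑' k : ℤ, Matrix.fromBlocks (Pp k) (Pm k) (Pm (-k)) (Pp (-k))

/-- The discrete moment `(1/√d) ∑_{k ∈ ℤ} k^j C_k` of a family of matrices. -/
def discreteMoment {r : ℕ} (d : ℕ) (C : ℤ → Matrix (Fin r) (Fin r) ℝ) (j : ℕ) :
    Matrix (Fin r) (Fin r) ℝ :=
  (1 / Real.sqrt d) • ∑' k : ℤ, (k : ℝ) ^ j • C k

/-- The continuous moment `∫ x^j f(x) dx`, a vector of size `r`. -/
def moment {𝕜 : Type*} [RCLike 𝕜] {r : ℕ} (f : ℝ → Fin r → 𝕜) (j : ℕ) : Fin r → 𝕜 :=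
  ∫ x : ℝ, (x ^ j) • f x

/-- The matrix `d^j I_r - [M_0⁺ + (-1)^j M_0⁻]`. -/
def sepMatrix {r : ℕ} (d : ℕ) (Pp Pm : ℤ → Matrix (Fin r) (Fin r) ℝ) (j : ℕ) :
    Matrix (Fin r) (Fin r) ℝ :=
  (d : ℝ) ^ j • (1 : Matrix (Fin r) (Fin r) ℝ) -
    (discreteMoment d Pp 0 + (-1 : ℝ) ^ j • discreteMoment d Pm 0)

/-- `binom(j, ℓ) [C⁺_{j-ℓ} + (-1)^ℓ C⁻_{j-ℓ}] v`, with `C^±_i` the discrete moments of the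
coefficient families. It is used for `ℓ ≤ j` only. -/
def sepTerm {𝕜 : Type*} [RCLike 𝕜] {r : ℕ} (d : ℕ) (Cp Cm : ℤ → Matrix (Fin r) (Fin r) ℝ)
    (j l : ℕ) (v : Fin r → 𝕜) : Fin r → 𝕜 :=
  (j.choose l : ℝ) •
    act (discreteMoment d Cp (j - l) + (-1 : ℝ) ^ l • discreteMoment d Cm (j - l)) v

end

end TwoDirection

open TwoDirection

/-!
Orthogonality makes the coefficients of a two-direction recursion inner products,
`C_k = √d ∫ f(x) φ(± (d x - k))^* dx`. As `φ` is bounded with compact support, they vanish for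
large `|k|` when `f` has compact support, and `∑ |k|^j ‖C_k‖ < ∞` when `x^j f` is integrable. So
the recursion can be multiplied by `x^j` and integrated term by term; the binomial expansion of
`x^j = d^{-j} ((d x - k) + k)^j` gives the moment formulas.

The matrix of Condition E has the form `[[B, C], [C, B]]`, with characteristic polynomial
`χ_{B+C} χ_{B-C}`. Hence `d^j I - (B + (-1)^j C)` is invertible for `j ≥ 1`, and the eigenvalue `1`
of `M_0 = B + C` is simple.

The normalization of `m_0` comes from projecting the indicator function of `[0, 1]` onto `V_n`: as
`n → ∞` the squared norm of the projection tends to `1`, while in the orthonormal basis of `V_n` it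
is a sum over `d^n + O(1)` translates and two directions, nearly all of whose terms equal
`d^{-n} |m_{0,i}|^2`. It therefore tends to `2 m_0^* m_0`.
-/

namespace TwoDirection

section ConditionE

theorem charpoly_fromBlocks_circulant {n K : Type*} [Fintype n] [DecidableEq n] [CommRing K]
    (B C : Matrix n n K) :
    (Matrix.fromBlocks B C C B).charpoly = (B + C).charpoly * (B - C).charpoly := by
  let U : (Matrix (n ⊕ n) (n ⊕ n) K)ˣ :=
    { val := Matrix.fromBlocks 1 0 (-1) 1
      inv := Matrix.fromBlocks 1 0 1 1
      val_inv := by simp [Matrix.fromBlocks_multiply]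
      inv_val := by simp [Matrix.fromBlocks_multiply] }
  have conj : U.val * Matrix.fromBlocks B C C B * (U⁻¹).val =
      Matrix.fromBlocks (B + C) C 0 (B - C) := by
    change Matrix.fromBlocks 1 0 (-1) 1 * Matrix.fromBlocks B C C B *
      Matrix.fromBlocks 1 0 1 1 = _
    simp only [Matrix.fromBlocks_multiply]
    congr 1 <;> simp
    abel
  rw [← Matrix.charpoly_units_conj U, ← Matrix.coe_units_inv, conj,
    Matrix.charpoly_fromBlocks_zero₂₁]

theorem exists_eq_smul_of_rootMultiplicity_charpoly_le_one {n K : Type*} [Fintype n]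
    [DecidableEq n] [Field K] {A : Matrix n n K} {μ : K}
    (hμ : A.charpoly.rootMultiplicity μ ≤ 1) {v w : n → K}
    (hv : A.mulVec v = μ • v) (hw : A.mulVec w = μ • w) (hw0 : w ≠ 0) : ∃ c : K, v = c • w := by
  have mem {u : n → K} (hu : A.mulVec u = μ • u) :
      u ∈ Module.End.eigenspace (Matrix.toLin' A) μ := by
    rwa [Module.End.mem_eigenspace_iff, Matrix.toLin'_apply]
  have hfin : Module.finrank K (Module.End.eigenspace (Matrix.toLin' A) μ) ≤ 1 :=
    (LinearMap.finrank_eigenspace_le _ μ).trans (by rwa [Matrix.charpoly_toLin'])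
  obtain ⟨g, hg⟩ := finrank_le_one_iff.1 hfin
  obtain ⟨a, ha⟩ := hg ⟨v, mem hv⟩
  obtain ⟨b, hb⟩ := hg ⟨w, mem hw⟩
  have hv' : a • (g : n → K) = v := congrArg Subtype.val ha
  have hw' : b • (g : n → K) = w := congrArg Subtype.val hb
  have hb0 : b ≠ 0 := by
    rintro rfl
    exact hw0 (by rw [← hw', zero_smul])
  exact ⟨a / b, by rw [← hv', ← hw', smul_smul, div_mul_cancel₀ a hb0]⟩

variable {n : Type*} [Fintype n] [DecidableEq n] {A : Matrix n n ℝ}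

theorem ConditionE.rootMultiplicity_eq_one (hA : ConditionE (A.map (algebraMap ℝ ℂ))) :
    A.charpoly.rootMultiplicity 1 = 1 := by
  rw [Polynomial.eq_rootMultiplicity_map (algebraMap ℝ ℂ).injective, ← Matrix.charpoly_map,
    map_one, hA.1]

theorem ConditionE.not_isRoot_of_one_lt (hA : ConditionE (A.map (algebraMap ℝ ℂ))) {x : ℝ}
    (hx : 1 < x) : ¬ A.charpoly.IsRoot x := by
  intro hroot
  have hspec : (x : ℂ) ∈ spectrum ℂ (A.map (algebraMap ℝ ℂ)) := by
    rw [Matrix.mem_spectrum_iff_isRoot_charpoly, Matrix.charpoly_map]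
    exact hroot.map
  have hlt := hA.2 x hspec (by exact_mod_cast hx.ne')
  rw [Complex.norm_real, Real.norm_of_nonneg (by linarith)] at hlt
  exact hx.not_gt hlt

variable {B C : Matrix n n ℝ}

theorem ConditionE.isUnit_smul_one_sub
    (hE : ConditionE ((Matrix.fromBlocks B C C B).map (algebraMap ℝ ℂ))) {x : ℝ} (hx : 1 < x)
    (j : ℕ) : IsUnit (x • (1 : Matrix n n ℝ) - (B + (-1 : ℝ) ^ j • C)) := by
  have hroot := hE.not_isRoot_of_one_lt hx
  rw [charpoly_fromBlocks_circulant, Polynomial.root_mul, not_or] at hroot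
  rw [← Algebra.algebraMap_eq_smul_one, ← spectrum.notMem_iff,
    Matrix.mem_spectrum_iff_isRoot_charpoly]
  rcases j.even_or_odd with hj | hj
  · simpa only [hj.neg_one_pow, one_smul] using hroot.1
  · simpa only [hj.neg_one_pow, neg_smul, one_smul, ← sub_eq_add_neg] using hroot.2

theorem ConditionE.rootMultiplicity_add_le_one
    (hE : ConditionE ((Matrix.fromBlocks B C C B).map (algebraMap ℝ ℂ))) :
    (B + C).charpoly.rootMultiplicity 1 ≤ 1 := by
  have hmult := hE.rootMultiplicity_eq_one
  have hne : (B + C).charpoly * (B - C).charpoly ≠ 0 :=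
    ((B + C).charpoly_monic.mul (B - C).charpoly_monic).ne_zero
  rw [charpoly_fromBlocks_circulant, Polynomial.rootMultiplicity_mul hne] at hmult
  omega

end ConditionE

variable {𝕜 : Type*} [RCLike 𝕜] {r : ℕ}

section Act

theorem act_apply (A : Matrix (Fin r) (Fin r) ℝ) (v : Fin r → 𝕜) (a : Fin r) :
    act A v a = ∑ b, algebraMap ℝ 𝕜 (A a b) * v b := rfl

theorem act_one (v : Fin r → 𝕜) : act 1 v = v := by
  rw [act, Matrix.map_one _ (map_zero _) (map_one _), Matrix.one_mulVec]

theorem act_mul (A B : Matrix (Fin r) (Fin r) ℝ) (v : Fin r → 𝕜) :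
    act (A * B) v = act A (act B v) := by
  rw [act, Matrix.map_mul, ← Matrix.mulVec_mulVec, act, act]

variable (𝕜) in
/-- `act` as a continuous real-bilinear map. -/
noncomputable def actL :
    Matrix (Fin r) (Fin r) ℝ →L[ℝ] (Fin r → 𝕜) →L[ℝ] (Fin r → 𝕜) :=
  LinearMap.toContinuousBilinearMap <| LinearMap.mk₂ ℝ act
    (fun A B v => by simp only [act, Matrix.map_add _ (map_add _), Matrix.add_mulVec])
    (fun c A v => by
      ext a
      simp only [act_apply, Matrix.smul_apply, smul_eq_mul, map_mul, Pi.smul_apply,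
        RCLike.real_smul_eq_coe_mul, RCLike.algebraMap_eq_ofReal, Finset.mul_sum, mul_assoc])
    (fun _ _ _ => Matrix.mulVec_add _ _ _)
    (fun _ _ _ => Matrix.mulVec_smul _ _ _)

theorem actL_apply (A : Matrix (Fin r) (Fin r) ℝ) (v : Fin r → 𝕜) : actL 𝕜 A v = act A v := rfl

theorem act_smul_one_sub (c : ℝ) (A : Matrix (Fin r) (Fin r) ℝ) (v : Fin r → 𝕜) :
    act (c • 1 - A) v = c • v - act A v := by
  simp only [← actL_apply, map_sub, map_smul, sub_apply, smul_apply]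
  rw [actL_apply (𝕜 := 𝕜) 1, act_one]

theorem exists_eq_smul_of_act_eq {A : Matrix (Fin r) (Fin r) ℝ}
    (hA : A.charpoly.rootMultiplicity 1 ≤ 1) {v w : Fin r → 𝕜} (hv : act A v = v)
    (hw : act A w = w) (hw0 : w ≠ 0) : ∃ c : 𝕜, v = c • w := by
  refine exists_eq_smul_of_rootMultiplicity_charpoly_le_one (A := A.map (algebraMap ℝ 𝕜))
    (μ := 1) ?_ (hv.trans (one_smul 𝕜 v).symm) (hw.trans (one_smul 𝕜 w).symm) hw0
  rwa [Matrix.charpoly_map, ← map_one (algebraMap ℝ 𝕜),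
    ← Polynomial.eq_rootMultiplicity_map (algebraMap ℝ 𝕜).injective]

end Act

section DiscreteMoments

variable {d : ℕ} {Cp Cm : ℤ → Matrix (Fin r) (Fin r) ℝ}

theorem doubledMask_eq_fromBlocks (hp : Summable Cp) (hm : Summable Cm) :
    doubledMask d Cp Cm = Matrix.fromBlocks (discreteMoment d Cp 0) (discreteMoment d Cm 0)
      (discreteMoment d Cm 0) (discreteMoment d Cp 0) := by
  have hsum : HasSum (fun k => Matrix.fromBlocks (Cp k) (Cm k) (Cm (-k)) (Cp (-k)))
      (Matrix.fromBlocks (∑' k, Cp k) (∑' k, Cm k) (∑' k, Cm k) (∑' k, Cp k)) := by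
    have entry {A : ℤ → Matrix (Fin r) (Fin r) ℝ} (hA : Summable A) (a b : Fin r) :
        HasSum (fun k => A k a b) ((∑' k, A k) a b) :=
      Pi.hasSum.1 (Pi.hasSum.1 hA.hasSum a) b
    refine Pi.hasSum.2 fun a => Pi.hasSum.2 fun b => ?_
    rcases a with a | a <;> rcases b with b | b
    · exact entry hp a b
    · exact entry hm a b
    · exact (Equiv.neg ℤ).hasSum_iff.2 (entry hm a b)
    · exact (Equiv.neg ℤ).hasSum_iff.2 (entry hp a b)
  simp only [doubledMask, discreteMoment, pow_zero, one_smul, hsum.tsum_eq,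
    Matrix.fromBlocks_smul]

theorem discreteMoment_zero_add (hp : Summable Cp) (hm : Summable Cm) :
    discreteMoment d (fun k => Cp k + Cm k) 0 =
      discreteMoment d Cp 0 + discreteMoment d Cm 0 := by
  simp only [discreteMoment, pow_zero, one_smul, hp.tsum_add hm, smul_add]

theorem rootMultiplicity_discreteMoment_add_le_one (hp : Summable Cp) (hm : Summable Cm)
    (hE : ConditionE ((doubledMask d Cp Cm).map (algebraMap ℝ ℂ))) :
    (discreteMoment d (fun k => Cp k + Cm k) 0).charpoly.rootMultiplicity 1 ≤ 1 := by
  rw [doubledMask_eq_fromBlocks hp hm] at hE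
  rw [discreteMoment_zero_add hp hm]
  exact hE.rootMultiplicity_add_le_one

theorem hasSum_discreteMoment {C : ℤ → Matrix (Fin r) (Fin r) ℝ} {j : ℕ}
    (h : Summable fun k : ℤ => (k : ℝ) ^ j • C k) (v : Fin r → 𝕜) :
    HasSum (fun k : ℤ => (1 / √(d : ℝ) * (k : ℝ) ^ j) • act (C k) v)
      (act (discreteMoment d C j) v) := by
  have hsum : HasSum (fun k : ℤ => (1 / √(d : ℝ)) • ((k : ℝ) ^ j • C k)) (discreteMoment d C j) :=
    h.hasSum.const_smul _
  simpa only [map_smul, smul_apply, smul_smul, ContinuousLinearMap.apply_apply, actL_apply]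
    using (ContinuousLinearMap.apply ℝ _ v).hasSum ((actL 𝕜).hasSum hsum)

theorem isUnit_sepMatrix (hd : 2 ≤ d) (hp : Summable Cp) (hm : Summable Cm)
    (hE : ConditionE ((doubledMask d Cp Cm).map (algebraMap ℝ ℂ))) {j : ℕ} (hj : 1 ≤ j) :
    IsUnit (sepMatrix d Cp Cm j) := by
  rw [doubledMask_eq_fromBlocks hp hm] at hE
  exact hE.isUnit_smul_one_sub (one_lt_pow₀ (by exact_mod_cast hd) (by omega)) j

end DiscreteMoments

/-- A bounded integrable function that vanishes outside `[-R, R]`. The radius is a natural number,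
so that it can be added to the integer translates. -/
structure IsWindow {E : Type*} [NormedAddCommGroup E] (R : ℕ) (B : ℝ) (g : ℝ → E) : Prop where
  integrable : Integrable g
  norm_le : ∀ x, ‖g x‖ ≤ B
  eq_zero : ∀ x, (R : ℝ) < |x| → g x = 0

section Window

variable {E : Type*} [NormedAddCommGroup E] {R : ℕ} {B : ℝ} {g : ℝ → E}

theorem memLp_two_of_norm_le (hint : Integrable g) (hB : ∀ x, ‖g x‖ ≤ B) : MemLp g 2 := by
  refine (memLp_two_iff_integrable_sq_norm hint.aestronglyMeasurable).2 ?_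
  simpa only [sq] using hint.norm.mul_bdd hint.norm.aestronglyMeasurable
    (Filter.Eventually.of_forall fun x => (norm_norm (g x)).trans_le (hB x))

theorem exists_isWindow (hmeas : AEStronglyMeasurable g) (hbdd : Bornology.IsBounded (Set.range g))
    (hsupp : HasCompactSupport g) : ∃ R B, IsWindow R B g := by
  obtain ⟨B, hB⟩ := hbdd.exists_norm_le
  obtain ⟨S, hS⟩ := hsupp.isCompact.isBounded.exists_norm_le
  obtain ⟨R, hR⟩ := exists_nat_ge S
  have norm_le : ∀ x, ‖g x‖ ≤ B := fun x => hB _ ⟨x, rfl⟩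
  have hint : Integrable g :=
    (integrableOn_iff_integrable_of_support_subset (subset_tsupport g)).1
      (Measure.integrableOn_of_bounded hsupp.isCompact.measure_lt_top.ne hmeas
        (Filter.Eventually.of_forall norm_le))
  refine ⟨R, B, hint, norm_le, fun x hx => ?_⟩
  by_contra h
  exact (((hS x (subset_tsupport g h)).trans hR).trans_lt hx).false

namespace IsWindow

theorem bound_nonneg (hg : IsWindow R B g) : 0 ≤ B := (norm_nonneg _).trans (hg.norm_le 0)

theorem abs_le_of_ne_zero (hg : IsWindow R B g) {x : ℝ} (hx : g x ≠ 0) : |x| ≤ R :=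
  not_lt.1 fun h => hx (hg.eq_zero x h)

theorem apply {g : ℝ → Fin r → 𝕜} (hg : IsWindow R B g) (b : Fin r) :
    IsWindow R B fun x => g x b where
  integrable := hg.integrable.eval b
  norm_le x := (norm_le_pi_norm _ b).trans (hg.norm_le x)
  eq_zero x hx := congrFun (hg.eq_zero x hx) b

theorem continuous_smul [NormedSpace ℝ E] (hg : IsWindow R B g) {u : ℝ → ℝ} (hu : Continuous u) :
    Integrable fun x => u x • g x := by
  refine (integrableOn_iff_integrable_of_support_subset (s := Set.Icc (-(R : ℝ)) R) ?_).1
    (hg.integrable.integrableOn.continuousOn_smul hu.continuousOn isCompact_Icc)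
  intro x hx
  exact abs_le.1 (hg.abs_le_of_ne_zero (right_ne_zero_of_smul hx))

theorem sum_norm_comp_sub_le (hg : IsWindow R B g) (y : ℝ) (s : Finset ℤ) :
    ∑ k ∈ s, ‖g (y - k)‖ ≤ (2 * R + 1) * B := by
  set W : Finset ℤ := Finset.Icc ⌈y - R⌉ ⌊y + R⌋ with hW
  have hWcard : (W.card : ℝ) ≤ 2 * R + 1 := by
    have hint : (W.card : ℤ) ≤ 2 * R + 1 := by
      have hfloor : (⌊y + R⌋ : ℝ) - ⌈y - R⌉ ≤ 2 * R := by
        linarith [Int.floor_le (y + R), Int.le_ceil (y - R)]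
      have hfloor' : ⌊y + R⌋ - ⌈y - R⌉ ≤ 2 * R := by exact_mod_cast hfloor
      rw [hW, Int.card_Icc]
      omega
    exact_mod_cast hint
  have subset_W : {k ∈ s | ‖g (y - (k : ℤ))‖ ≠ 0} ⊆ W := fun k hk => by
    have hyk := abs_le.1 (hg.abs_le_of_ne_zero (norm_ne_zero_iff.1 (Finset.mem_filter.1 hk).2))
    exact Finset.mem_Icc.2 ⟨Int.ceil_le.2 (by linarith), Int.le_floor.2 (by linarith)⟩
  calc ∑ k ∈ s, ‖g (y - k)‖ = ∑ k ∈ s with ‖g (y - (k : ℤ))‖ ≠ 0, ‖g (y - k)‖ :=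
        (Finset.sum_filter_ne_zero s).symm
    _ ≤ ∑ k ∈ W, ‖g (y - k)‖ :=
        Finset.sum_le_sum_of_subset_of_nonneg subset_W fun _ _ _ => norm_nonneg _
    _ ≤ W.card • B := Finset.sum_le_card_nsmul _ _ _ fun k _ => hg.norm_le _
    _ ≤ (2 * R + 1) * B := by
        rw [nsmul_eq_mul]
        exact mul_le_mul_of_nonneg_right hWcard hg.bound_nonneg

end IsWindow

end Window

section Shifts

variable {d : ℕ} {φ : ℝ → Fin r → 𝕜} {R : ℕ} {B : ℝ}

/-- The sign of the argument of `φ` that belongs to a tag: `1` for `true`, `-1` for `false`. -/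
def tagSign (σ : Bool) : ℝ := if σ then 1 else -1

theorem tagSign_mul_self (σ : Bool) : tagSign σ * tagSign σ = 1 := by
  cases σ <;> simp [tagSign]

theorem tagSign_ne_zero (σ : Bool) : tagSign σ ≠ 0 :=
  left_ne_zero_of_mul_eq_one (tagSign_mul_self σ)

theorem abs_tagSign_mul (σ : Bool) (x : ℝ) : |tagSign σ * x| = |x| := by
  cases σ <;> simp [tagSign]

theorem shift_apply (n : ℤ) (b : Fin r) (k : ℤ) (σ : Bool) (x : ℝ) :
    shift d φ n (b, k, σ) x = φ (tagSign σ * ((d : ℝ) ^ n * x - k)) b := by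
  cases σ <;> simp [shift, tagSign]

theorem IsWindow.comp_tagSign {E : Type*} [NormedAddCommGroup E] {g : ℝ → E}
    (hg : IsWindow R B g) (σ : Bool) : IsWindow R B fun x => g (tagSign σ * x) where
  integrable := hg.integrable.comp_mul_left' (tagSign_ne_zero σ)
  norm_le x := hg.norm_le _
  eq_zero x hx := hg.eq_zero _ (by rwa [abs_tagSign_mul])

theorem integrable_shift (hφ : IsWindow R B φ) (hd : d ≠ 0) (n : ℤ) (p : Fin r × ℤ × Bool) :
    Integrable (shift d φ n p) := by
  obtain ⟨b, k, σ⟩ := p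
  simp only [funext (shift_apply n b k σ)]
  exact (((hφ.apply b).comp_tagSign σ).integrable.comp_sub_right (k : ℝ)).comp_mul_left'
    (zpow_ne_zero n (Nat.cast_ne_zero.2 hd))

theorem norm_shift_le (hφ : IsWindow R B φ) (n : ℤ) (p : Fin r × ℤ × Bool) (x : ℝ) :
    ‖shift d φ n p x‖ ≤ B := by
  obtain ⟨b, k, σ⟩ := p
  rw [shift_apply]
  exact (hφ.apply b).norm_le _

theorem memLp_shift (hφ : IsWindow R B φ) (hd : d ≠ 0) (n : ℤ) (p : Fin r × ℤ × Bool) :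
    MemLp (shift d φ n p) 2 :=
  memLp_two_of_norm_le (integrable_shift hφ hd n p) (norm_shift_le hφ n p)

theorem abs_le_of_shift_ne_zero (hφ : IsWindow R B φ) {n k : ℤ} {b : Fin r} {σ : Bool} {x : ℝ}
    (h : shift d φ n (b, k, σ) x ≠ 0) : |(d : ℝ) ^ n * x - k| ≤ R := by
  rw [shift_apply] at h
  simpa only [abs_tagSign_mul] using (hφ.apply b).abs_le_of_ne_zero h

theorem integral_shift_zero_mul_star (horth : TwoDirection.Orthogonal φ)
    (p q : Fin r × ℤ × Bool) :
    ∫ y, shift d φ 0 p y * star (shift d φ 0 q y) = if p = q then 1 else 0 := by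
  have same (b c : Fin r) (k l : ℤ) :
      ∫ y, φ (y - k) b * star (φ (y - l) c) = if b = c ∧ k = l then 1 else 0 := by
    have h := congrFun₂ (horth k l).1 b c
    rw [gram, Matrix.of_apply] at h
    rw [h]
    by_cases hkl : k = l <;> simp [hkl, Matrix.one_apply]
  have mixed (b c : Fin r) (k l : ℤ) : ∫ y, φ (y - k) b * star (φ (l - y) c) = 0 :=
    congrFun₂ (horth k l).2 b c
  obtain ⟨b, k, σ⟩ := p
  obtain ⟨c, l, τ⟩ := q
  cases σ <;> cases τ <;>
    simp only [shift, zpow_zero, one_mul, Prod.mk.injEq, and_true, if_true, reduceCtorEq,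
      and_false, if_false, Bool.false_eq_true]
  · rw [← integral_neg_eq_self]
    simpa [add_comm] using same b c (-k) (-l)
  · have h := congrArg star (mixed c b l k)
    rw [← starRingEnd_apply, ← integral_conj] at h
    simpa [mul_comm] using h
  · exact mixed b c k l
  · exact same b c k l

theorem integral_shift_mul_star (horth : TwoDirection.Orthogonal φ) (n : ℤ)
    (p q : Fin r × ℤ × Bool) :
    ∫ x, shift d φ n p x * star (shift d φ n q x) =
      if p = q then algebraMap ℝ 𝕜 ((d : ℝ) ^ n)⁻¹ else 0 := by
  have scale (p : Fin r × ℤ × Bool) (x : ℝ) :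
      shift d φ n p x = shift d φ 0 p ((d : ℝ) ^ n * x) := by
    simp only [shift, zpow_zero, one_mul]
  simp only [scale]
  rw [Measure.integral_comp_mul_left (fun y => shift d φ 0 p y * star (shift d φ 0 q y)),
    integral_shift_zero_mul_star horth, abs_of_nonneg (by positivity)]
  split_ifs
  · rw [Algebra.algebraMap_eq_smul_one]
  · exact smul_zero _

end Shifts

section Coefficients

variable {d : ℕ} {φ f : ℝ → Fin r → 𝕜} {C : Bool → ℤ → Matrix (Fin r) (Fin r) ℝ} {R : ℕ} {B : ℝ}

theorem abs_le_of_abs_mul_sub_le {x y c : ℝ} (h : |d * x - y| ≤ c) : |y| ≤ d * |x| + c := by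
  have hy : |y| - |d * x| ≤ c := (abs_sub_abs_le_abs_sub _ _).trans ((abs_sub_comm _ _).trans_le h)
  rw [abs_mul, Nat.abs_cast] at hy
  linarith

theorem mem_Icc_of_abs_mul_sub_le {x T c : ℝ} {N : ℕ} {k : ℤ} (hx : |x| ≤ T)
    (hN : d * T + c ≤ N) (hk : |d * x - k| ≤ c) : k ∈ Finset.Icc (-N : ℤ) N := by
  have hkN : |(k : ℝ)| ≤ N := by
    refine (abs_le_of_abs_mul_sub_le hk).trans (le_trans ?_ hN)
    gcongr
  have hkN' : |k| ≤ N := by exact_mod_cast hkN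
  exact Finset.mem_Icc.2 (abs_le.1 hkN')

theorem Recursion.apply_eq_sum (hf : Recursion d (C true) (C false) φ f) (hφ : IsWindow R B φ)
    {x : ℝ} {W : Finset ℤ} (hW : ∀ k : ℤ, |d * x - k| ≤ R → k ∈ W) (a : Fin r) :
    f x a = ∑ p ∈ Finset.univ ×ˢ W ×ˢ Finset.univ,
      algebraMap ℝ 𝕜 (√d * C p.2.2 p.2.1 a p.1) * shift d φ 1 p x := by
  have hzero (k : ℤ) (hk : k ∉ W) :
      √d • (act (C true k) (φ (d * x - k)) + act (C false k) (φ (k - d * x))) = 0 := by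
    have hlt : (R : ℝ) < |d * x - k| := not_le.1 fun h => hk (hW k h)
    rw [hφ.eq_zero _ hlt, hφ.eq_zero _ (by rwa [abs_sub_comm]), ← actL_apply, ← actL_apply,
      map_zero, map_zero, add_zero, smul_zero]
  have hsum : f x = ∑ k ∈ W,
      √d • (act (C true k) (φ (d * x - k)) + act (C false k) (φ (k - d * x))) :=
    (hf x).unique (hasSum_sum_of_ne_finset_zero hzero)
  rw [hsum, Finset.sum_apply, Finset.sum_product_right, Finset.sum_product]
  refine Finset.sum_congr rfl fun k _ => ?_
  simp [shift, act_apply, Finset.mul_sum, mul_assoc, RCLike.real_smul_eq_coe_mul]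

theorem Recursion.locallyIntegrable (hf : Recursion d (C true) (C false) φ f)
    (hφ : IsWindow R B φ) (hd : d ≠ 0) : LocallyIntegrable f := by
  refine locallyIntegrable_iff.2 fun K hK => Integrable.of_eval fun a => ?_
  obtain ⟨T, hT⟩ := hK.isBounded.exists_norm_le
  obtain ⟨N, hN⟩ := exists_nat_ge (d * T + R)
  have hint : Integrable fun x => ∑ p ∈ Finset.univ ×ˢ Finset.Icc (-N : ℤ) N ×ˢ Finset.univ,
      algebraMap ℝ 𝕜 (√d * C p.2.2 p.2.1 a p.1) * shift d φ 1 p x :=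
    integrable_finsetSum _ fun p _ => (integrable_shift hφ hd 1 p).const_mul _
  exact hint.integrableOn.congr_fun
    (fun x hx =>
      (hf.apply_eq_sum hφ (fun k => mem_Icc_of_abs_mul_sub_le (hT x hx) hN) a).symm)
    hK.isClosed.measurableSet

theorem Recursion.coeff_eq_integral (hf : Recursion d (C true) (C false) φ f)
    (hφ : IsWindow R B φ) (hd : d ≠ 0) (horth : TwoDirection.Orthogonal φ) (σ : Bool) (k : ℤ)
    (a b : Fin r) :
    algebraMap ℝ 𝕜 (C σ k a b) = √d • ∫ x, f x a * star (shift d φ 1 (b, k, σ) x) := by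
  set q : Fin r × ℤ × Bool := (b, k, σ) with hq
  set S : Finset (Fin r × ℤ × Bool) :=
    Finset.univ ×ˢ Finset.Icc (k - 2 * R) (k + 2 * R) ×ˢ Finset.univ with hS
  have expand (x : ℝ) : f x a * star (shift d φ 1 q x) = ∑ p ∈ S,
      algebraMap ℝ 𝕜 (√d * C p.2.2 p.2.1 a p.1) *
        (shift d φ 1 p x * star (shift d φ 1 q x)) := by
    by_cases hx : shift d φ 1 q x = 0
    · simp only [hx, star_zero, mul_zero, Finset.sum_const_zero]
    have hxk := abs_le.1 (abs_le_of_shift_ne_zero hφ hx)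
    rw [zpow_one] at hxk
    have hW (l : ℤ) (hl : |d * x - l| ≤ R) : l ∈ Finset.Icc (k - 2 * R) (k + 2 * R) := by
      have hl' := abs_le.1 hl
      have h1 : (k : ℝ) - 2 * R ≤ l := by linarith
      have h2 : (l : ℝ) ≤ k + 2 * R := by linarith
      exact Finset.mem_Icc.2 ⟨by exact_mod_cast h1, by exact_mod_cast h2⟩
    rw [hf.apply_eq_sum hφ hW, Finset.sum_mul]
    simp only [mul_assoc, hS]
  have hint (p : Fin r × ℤ × Bool) :
      Integrable fun x => shift d φ 1 p x * star (shift d φ 1 q x) :=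
    (integrable_shift hφ hd 1 p).mul_bdd (integrable_shift hφ hd 1 q).aestronglyMeasurable.star
      (Filter.Eventually.of_forall fun x => (norm_star _).trans_le (norm_shift_le hφ 1 q x))
  have hqS : q ∈ S := by simp [hS, hq]
  simp only [expand]
  rw [integral_finsetSum _ fun p _ => (hint p).const_mul _]
  simp only [integral_const_mul, integral_shift_mul_star horth, mul_ite, mul_zero,
    Finset.sum_ite_eq', hqS, if_true, zpow_one, ← map_mul, Algebra.smul_def]
  congr 1
  have hd' : (d : ℝ) ≠ 0 := Nat.cast_ne_zero.2 hd
  field_simp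
  rw [Real.sq_sqrt (Nat.cast_nonneg d)]
  exact mul_comm _ _

theorem Recursion.finite_support (hf : Recursion d (C true) (C false) φ f)
    (hφ : IsWindow R B φ) (hd : d ≠ 0) (horth : TwoDirection.Orthogonal φ)
    (hsupp : HasCompactSupport f) (σ : Bool) : (Function.support (C σ)).Finite := by
  obtain ⟨T, hT⟩ := hsupp.isCompact.isBounded.exists_norm_le
  obtain ⟨N, hN⟩ := exists_nat_ge (d * T + R)
  refine (Finset.Icc (-N : ℤ) N).finite_toSet.subset fun k hk => ?_
  obtain ⟨a, b, hab⟩ : ∃ a b, C σ k a b ≠ 0 := by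
    by_contra! h
    exact hk (Matrix.ext h)
  obtain ⟨x, hx⟩ : ∃ x, f x a * star (shift d φ 1 (b, k, σ) x) ≠ 0 := by
    by_contra! h
    have h0 := hf.coeff_eq_integral hφ hd horth σ k a b
    simp only [h, integral_zero, smul_zero, map_eq_zero] at h0
    exact hab h0
  have hxT := hT x (subset_tsupport f fun h => left_ne_zero_of_mul hx (congrFun h a))
  have hxk := abs_le_of_shift_ne_zero hφ (star_ne_zero.1 (right_ne_zero_of_mul hx))
  rw [zpow_one] at hxk
  exact mem_Icc_of_abs_mul_sub_le hxT hN hxk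

section

variable {E F : Type*} [NormedAddCommGroup E] [NormedAddCommGroup F] {g : ℝ → E} {h : ℝ → F}
  {a : ℝ}

theorem IsWindow.integrable_norm_mul (hg : IsWindow R B g) (hh : Integrable h) (ha : a ≠ 0)
    (y : ℝ) : Integrable fun x => ‖h x‖ * ‖g (a * x - y)‖ :=
  hh.norm.mul_bdd ((hg.integrable.comp_sub_right y).comp_mul_left' ha).norm.aestronglyMeasurable
    (Filter.Eventually.of_forall fun _ => (norm_norm _).trans_le (hg.norm_le _))

theorem IsWindow.summable_integral_norm_mul (hg : IsWindow R B g) (hh : Integrable h)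
    (ha : a ≠ 0) : Summable fun k : ℤ => ∫ x, ‖h x‖ * ‖g (a * x - k)‖ := by
  have hint (k : ℤ) := hg.integrable_norm_mul hh ha k
  refine summable_of_sum_le (fun k => integral_nonneg fun _ => by positivity)
    (c := ∫ x, ‖h x‖ * ((2 * R + 1) * B)) fun s => ?_
  rw [← integral_finsetSum _ fun k _ => hint k]
  refine integral_mono (integrable_finsetSum _ fun k _ => hint k) (hh.norm.mul_const _) fun x => ?_
  simp only [← Finset.mul_sum]
  exact mul_le_mul_of_nonneg_left (hg.sum_norm_comp_sub_le (a * x) s) (norm_nonneg _)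

end

theorem add_pow_le_mul_max_one_pow {a c t : ℝ} (ha : 0 ≤ a) (hc : 0 ≤ c) (ht : 0 ≤ t) {i j : ℕ}
    (hij : i ≤ j) : (a * t + c) ^ i ≤ (a + c) ^ i * max 1 t ^ j :=
  calc (a * t + c) ^ i ≤ (a * max 1 t + c * max 1 t) ^ i := by
        gcongr
        · exact le_max_right 1 t
        · exact le_mul_of_one_le_right hc (le_max_left 1 t)
    _ = (a + c) ^ i * max 1 t ^ i := by rw [← add_mul, mul_pow]
    _ ≤ (a + c) ^ i * max 1 t ^ j := by
        gcongr
        exact le_max_left 1 t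

theorem integrable_add_pow_smul {E : Type*} [NormedAddCommGroup E] [NormedSpace ℝ E]
    {g : ℝ → E} (hloc : LocallyIntegrable g) {i j : ℕ} (hij : i ≤ j)
    (hint : Integrable fun x => x ^ j • g x) {a c : ℝ} (ha : 0 ≤ a) (hc : 0 ≤ c) :
    Integrable fun x => (a * |x| + c) ^ i • g x := by
  set I : Set ℝ := Set.Icc (-1) 1
  have hnear : Integrable (I.indicator g) :=
    IntegrableOn.integrable_indicator (hloc.integrableOn_isCompact isCompact_Icc) measurableSet_Icc
  refine ((hnear.norm.add hint.norm).const_mul ((a + c) ^ i)).mono'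
    ((by fun_prop : Continuous fun x : ℝ => (a * |x| + c) ^ i).aestronglyMeasurable.smul
      hloc.aestronglyMeasurable) (Filter.Eventually.of_forall fun x => ?_)
  have hmax : max 1 |x| ^ j * ‖g x‖ ≤ ‖I.indicator g x‖ + ‖x ^ j • g x‖ := by
    rcases le_total |x| 1 with hx | hx
    · rw [max_eq_left hx, one_pow, one_mul, Set.indicator_of_mem (show x ∈ I from abs_le.1 hx)]
      exact le_add_of_nonneg_right (norm_nonneg _)
    · rw [max_eq_right hx, norm_smul (x ^ j), norm_pow, Real.norm_eq_abs]
      exact le_add_of_nonneg_left (norm_nonneg _)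
  calc ‖(a * |x| + c) ^ i • g x‖ = (a * |x| + c) ^ i * ‖g x‖ := by
        rw [norm_smul, Real.norm_of_nonneg (by positivity)]
    _ ≤ (a + c) ^ i * max 1 |x| ^ j * ‖g x‖ := by
        gcongr
        exact add_pow_le_mul_max_one_pow ha hc (abs_nonneg x) hij
    _ ≤ (a + c) ^ i * (‖I.indicator g x‖ + ‖x ^ j • g x‖) := by
        rw [mul_assoc]
        gcongr

theorem Recursion.summable_pow_smul_coeff (hf : Recursion d (C true) (C false) φ f)
    (hφ : IsWindow R B φ) (hd : d ≠ 0) (horth : TwoDirection.Orthogonal φ) {i j : ℕ}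
    (hij : i ≤ j) (hint : Integrable fun x => x ^ j • f x) (σ : Bool) :
    Summable fun k : ℤ => (k : ℝ) ^ i • C σ k := by
  refine Pi.summable.2 fun a => Pi.summable.2 fun b => ?_
  have hd' : (d : ℝ) ≠ 0 := Nat.cast_ne_zero.2 hd
  have hmaj : Integrable fun x : ℝ => ((d : ℝ) * |x| + R) ^ i • f x :=
    integrable_add_pow_smul (hf.locallyIntegrable hφ hd) hij hint (Nat.cast_nonneg d)
      (Nat.cast_nonneg R)
  have hsum := (hφ.comp_tagSign σ).summable_integral_norm_mul hmaj hd'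
  refine (hsum.mul_left √d).of_norm_bounded fun k => ?_
  have hle (x : ℝ) : ‖(k : ℝ) ^ i • (f x a * star (shift d φ 1 (b, k, σ) x))‖ ≤
      ‖(d * |x| + R) ^ i • f x‖ * ‖φ (tagSign σ * (d * x - k))‖ := by
    rcases eq_or_ne (shift d φ 1 (b, k, σ) x) 0 with hx | hx
    · simp only [hx, star_zero, mul_zero, smul_zero, norm_zero]
      positivity
    have hk := abs_le_of_shift_ne_zero hφ hx
    rw [zpow_one] at hk
    rw [norm_smul, norm_mul, norm_star, ← mul_assoc, shift_apply, zpow_one, norm_smul, norm_pow,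
      norm_pow, Real.norm_of_nonneg (by positivity : 0 ≤ d * |x| + (R : ℝ)), Real.norm_eq_abs]
    gcongr
    · exact abs_le_of_abs_mul_sub_le hk
    · exact norm_le_pi_norm _ a
    · exact norm_le_pi_norm _ b
  calc ‖(k : ℝ) ^ i * C σ k a b‖
      = √d * ‖∫ x, (k : ℝ) ^ i • (f x a * star (shift d φ 1 (b, k, σ) x))‖ := by
        rw [integral_smul, norm_mul, norm_smul, ← norm_algebraMap' 𝕜 (C σ k a b),
          hf.coeff_eq_integral hφ hd horth, norm_smul, Real.norm_of_nonneg (Real.sqrt_nonneg _)]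
        ring
    _ ≤ √d * ∫ x : ℝ, ‖((d : ℝ) * |x| + R) ^ i • f x‖ * ‖φ (tagSign σ * (d * x - k))‖ := by
        gcongr
        exact norm_integral_le_of_norm_le ((hφ.comp_tagSign σ).integrable_norm_mul hmaj hd' k)
          (Filter.Eventually.of_forall hle)

end Coefficients

section Moments

variable {d : ℕ} {φ f : ℝ → Fin r → 𝕜} {R : ℕ} {B : ℝ}

theorem integrable_comp_tagSign {E : Type*} [NormedAddCommGroup E] {g : ℝ → E}
    (hg : Integrable g) (hd : d ≠ 0) (σ : Bool) (k : ℤ) :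
    Integrable fun x : ℝ => g (tagSign σ * (d * x - k)) :=
  ((hg.comp_mul_left' (tagSign_ne_zero σ)).comp_sub_right (k : ℝ)).comp_mul_left'
    (Nat.cast_ne_zero.2 hd)

theorem integral_comp_natCast_mul_sub {E : Type*} [NormedAddCommGroup E] [NormedSpace ℝ E]
    (g : ℝ → E) (D : ℕ) (k : ℤ) : ∫ x : ℝ, g (D * x - k) = (D : ℝ)⁻¹ • ∫ y, g y := by
  rw [Measure.integral_comp_mul_left (fun y => g (y - k)) (D : ℝ),
    integral_sub_right_eq_self g (k : ℝ), abs_of_nonneg (by positivity)]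

theorem integral_comp_tagSign_mul {E : Type*} [NormedAddCommGroup E] [NormedSpace ℝ E]
    (g : ℝ → E) (σ : Bool) : ∫ y, g (tagSign σ * y) = ∫ y, g y := by
  have hσ : |(tagSign σ)⁻¹| = 1 := by cases σ <;> simp [tagSign]
  rw [Measure.integral_comp_mul_left, hσ, one_smul]

theorem integral_comp_tagSign {E : Type*} [NormedAddCommGroup E] [NormedSpace ℝ E]
    (g : ℝ → E) (d : ℕ) (σ : Bool) (k : ℤ) :
    ∫ x : ℝ, g (tagSign σ * (d * x - k)) = (d : ℝ)⁻¹ • ∫ y, g y := by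
  rw [integral_comp_natCast_mul_sub (fun y => g (tagSign σ * y)), integral_comp_tagSign_mul]

theorem pow_smul_comp_tagSign (hd : d ≠ 0) (j : ℕ) (σ : Bool) (k : ℤ) (x : ℝ) :
    x ^ j • φ (tagSign σ * (d * x - k)) =
      (fun y => ((tagSign σ * y + k) / d) ^ j • φ y) (tagSign σ * (d * x - k)) := by
  simp only [← mul_assoc, tagSign_mul_self, one_mul, sub_add_cancel,
    mul_div_cancel_left₀ x (Nat.cast_ne_zero.2 hd : (d : ℝ) ≠ 0)]

theorem IsWindow.integrable_pow_smul_comp (hφ : IsWindow R B φ) (hd : d ≠ 0) (j : ℕ) (σ : Bool)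
    (k : ℤ) : Integrable fun x : ℝ => x ^ j • φ (tagSign σ * (d * x - k)) := by
  simp only [pow_smul_comp_tagSign hd j σ k]
  exact integrable_comp_tagSign
    (hφ.continuous_smul (u := fun y => ((tagSign σ * y + k) / d) ^ j) (by fun_prop)) hd σ k

theorem IsWindow.integral_pow_smul_comp (hφ : IsWindow R B φ) (hd : d ≠ 0) (j : ℕ) (σ : Bool)
    (k : ℤ) :
    ∫ x : ℝ, x ^ j • φ (tagSign σ * (d * x - k)) =
      ((d : ℝ)⁻¹ * ((d : ℝ) ^ j)⁻¹) • ∑ l ∈ Finset.range (j + 1),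
        (j.choose l * tagSign σ ^ l * (k : ℝ) ^ (j - l)) • moment φ l := by
  have binomial (y : ℝ) : ((tagSign σ * y + k) / d) ^ j • φ y =
      ((d : ℝ) ^ j)⁻¹ • ∑ l ∈ Finset.range (j + 1),
        (j.choose l * tagSign σ ^ l * (k : ℝ) ^ (j - l)) • y ^ l • φ y := by
    rw [div_pow, add_pow, div_eq_inv_mul, mul_smul, Finset.sum_smul]
    congr 1
    refine Finset.sum_congr rfl fun l _ => ?_
    rw [smul_smul, mul_pow]
    ring_nf
  simp only [pow_smul_comp_tagSign hd j σ k]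
  rw [integral_comp_tagSign (fun y => ((tagSign σ * y + k) / d) ^ j • φ y), mul_smul]
  simp only [binomial]
  rw [integral_smul, integral_finsetSum]
  · simp only [integral_smul, moment]
  · exact fun l _ => (hφ.continuous_smul (continuous_pow l)).smul
      (j.choose l * tagSign σ ^ l * (k : ℝ) ^ (j - l))

theorem IsWindow.integral_norm_pow_smul_comp_le (hφ : IsWindow R B φ) (hd : d ≠ 0) (j : ℕ)
    (σ : Bool) (k : ℤ) :
    ∫ x : ℝ, ‖x ^ j • φ (tagSign σ * (d * x - k))‖ ≤ (|(k : ℝ)| + R) ^ j * ∫ y, ‖φ y‖ := by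
  have hd1 : (1 : ℝ) ≤ d := Nat.one_le_cast.2 (Nat.one_le_iff_ne_zero.2 hd)
  have hbound (y : ℝ) : ‖((tagSign σ * y + k) / d) ^ j • φ y‖ ≤ (|(k : ℝ)| + R) ^ j * ‖φ y‖ := by
    by_cases hy : φ y = 0
    · simp only [hy, smul_zero, norm_zero, mul_zero, le_refl]
    rw [norm_smul, norm_pow, Real.norm_eq_abs, abs_div, Nat.abs_cast]
    gcongr
    refine (div_le_self (abs_nonneg _) hd1).trans ((abs_add_le _ _).trans ?_)
    rw [abs_tagSign_mul, add_comm]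
    gcongr
    exact hφ.abs_le_of_ne_zero hy
  simp only [pow_smul_comp_tagSign hd j σ k]
  calc ∫ x : ℝ, ‖(fun y => ((tagSign σ * y + k) / d) ^ j • φ y) (tagSign σ * (d * x - k))‖
      = (d : ℝ)⁻¹ * ∫ y, ‖((tagSign σ * y + k) / d) ^ j • φ y‖ :=
        integral_comp_tagSign (fun y => ‖((tagSign σ * y + k) / d) ^ j • φ y‖) d σ k
    _ ≤ ∫ y, ‖((tagSign σ * y + k) / d) ^ j • φ y‖ :=
        mul_le_of_le_one_left (integral_nonneg fun _ => norm_nonneg _) (inv_le_one_of_one_le₀ hd1)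
    _ ≤ ∫ y, (|(k : ℝ)| + R) ^ j * ‖φ y‖ := integral_mono
        (hφ.continuous_smul (u := fun y => ((tagSign σ * y + k) / d) ^ j) (by fun_prop)).norm
        (hφ.integrable.norm.const_mul _) hbound
    _ = (|(k : ℝ)| + R) ^ j * ∫ y, ‖φ y‖ := integral_const_mul _ _

section Side

variable {C : ℤ → Matrix (Fin r) (Fin r) ℝ}

theorem norm_act_le (A : Matrix (Fin r) (Fin r) ℝ) (v : Fin r → 𝕜) :
    ‖act A v‖ ≤ (∑ a, ∑ b, |A a b|) * ‖v‖ := by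
  refine (pi_norm_le_iff_of_nonneg (by positivity)).2 fun a => ?_
  calc ‖act A v a‖ ≤ ∑ b, ‖algebraMap ℝ 𝕜 (A a b) * v b‖ := by
        rw [act_apply]
        exact norm_sum_le _ _
    _ ≤ ∑ b, |A a b| * ‖v‖ := by
        gcongr with b
        rw [norm_mul, norm_algebraMap', Real.norm_eq_abs]
        gcongr
        exact norm_le_pi_norm v b
    _ = (∑ b, |A a b|) * ‖v‖ := (Finset.sum_mul _ _ _).symm
    _ ≤ (∑ a, ∑ b, |A a b|) * ‖v‖ :=
        mul_le_mul_of_nonneg_right (Finset.single_le_sum (f := fun a => ∑ b, |A a b|)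
          (fun _ _ => Finset.sum_nonneg fun _ _ => abs_nonneg _) (Finset.mem_univ a))
          (norm_nonneg v)

theorem max_one_pow_le_one_add_pow {t : ℝ} (ht : 0 ≤ t) (j : ℕ) : max 1 t ^ j ≤ 1 + t ^ j := by
  rcases le_total 1 t with h | h
  · rw [max_eq_right h]
    exact le_add_of_nonneg_left zero_le_one
  · rw [max_eq_left h, one_pow]
    exact le_add_of_nonneg_right (pow_nonneg ht j)

theorem summable_abs_add_pow_mul_sum_abs {j : ℕ} {c : ℝ} (hc : 0 ≤ c) (h₀ : Summable C)
    (hj : Summable fun k : ℤ => (k : ℝ) ^ j • C k) :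
    Summable fun k : ℤ => (|(k : ℝ)| + c) ^ j * ∑ a, ∑ b, |C k a b| := by
  simp only [Finset.mul_sum]
  refine summable_sum fun a _ => summable_sum fun b _ => ?_
  have h₀ab : Summable fun k => |C k a b| := (Pi.summable.1 (Pi.summable.1 h₀ a) b).abs
  have hjab : Summable fun k : ℤ => |(k : ℝ)| ^ j * |C k a b| := by
    simpa only [Matrix.smul_apply, Pi.smul_apply, smul_eq_mul, abs_mul, abs_pow]
      using (Pi.summable.1 (Pi.summable.1 hj a) b).abs
  refine Summable.of_nonneg_of_le (fun k => by positivity) (fun k => ?_)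
    ((h₀ab.add hjab).mul_left ((1 + c) ^ j))
  calc (|(k : ℝ)| + c) ^ j * |C k a b|
      ≤ (1 + c) ^ j * max 1 |(k : ℝ)| ^ j * |C k a b| := by
        gcongr
        simpa only [one_mul] using
          add_pow_le_mul_max_one_pow zero_le_one hc (abs_nonneg (k : ℝ)) le_rfl
    _ ≤ (1 + c) ^ j * (1 + |(k : ℝ)| ^ j) * |C k a b| := by
        gcongr
        exact max_one_pow_le_one_add_pow (abs_nonneg _) j
    _ = _ := by ring

theorem IsWindow.summable_integral_norm_act (hφ : IsWindow R B φ) (hd : d ≠ 0) {j : ℕ}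
    (h₀ : Summable C) (hj : Summable fun k : ℤ => (k : ℝ) ^ j • C k) (σ : Bool) :
    Summable fun k => ∫ x : ℝ, ‖√d • act (C k) (x ^ j • φ (tagSign σ * (d * x - k)))‖ := by
  refine Summable.of_nonneg_of_le (fun k => integral_nonneg fun _ => norm_nonneg _) (fun k => ?_)
    ((summable_abs_add_pow_mul_sum_abs (Nat.cast_nonneg R) h₀ hj).mul_left
      (√d * ∫ y, ‖φ y‖))
  have hX := hφ.integrable_pow_smul_comp hd j σ k
  calc ∫ x : ℝ, ‖√d • act (C k) (x ^ j • φ (tagSign σ * (d * x - k)))‖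
      ≤ ∫ x : ℝ, √d * ((∑ a, ∑ b, |C k a b|) * ‖x ^ j • φ (tagSign σ * (d * x - k))‖) := by
        refine integral_mono (((actL 𝕜 (C k)).integrable_comp hX).smul √d).norm
          ((hX.norm.const_mul _).const_mul _) fun x => ?_
        rw [norm_smul √(d : ℝ), Real.norm_of_nonneg (Real.sqrt_nonneg _)]
        gcongr
        exact norm_act_le _ _
    _ ≤ √d * ((∑ a, ∑ b, |C k a b|) * ((|(k : ℝ)| + R) ^ j * ∫ y, ‖φ y‖)) := by
        rw [integral_const_mul, integral_const_mul]
        gcongr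
        exact hφ.integral_norm_pow_smul_comp_le hd j σ k
    _ = _ := by ring

theorem IsWindow.hasSum_integral_act (hφ : IsWindow R B φ) (hd : d ≠ 0) {j : ℕ}
    (hC : ∀ i ≤ j, Summable fun k : ℤ => (k : ℝ) ^ i • C k) (σ : Bool) :
    HasSum (fun k => ∫ x : ℝ, √d • act (C k) (x ^ j • φ (tagSign σ * (d * x - k))))
      (((d : ℝ) ^ j)⁻¹ • ∑ l ∈ Finset.range (j + 1),
        (j.choose l * tagSign σ ^ l) • act (discreteMoment d C (j - l)) (moment φ l)) := by
  have hsqrt : √d * ((d : ℝ)⁻¹ * ((d : ℝ) ^ j)⁻¹) = ((d : ℝ) ^ j)⁻¹ * (1 / √d) := by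
    rw [← mul_assoc, ← div_eq_mul_inv √(d : ℝ), Real.sqrt_div_self', mul_comm]
  have hterm (k : ℤ) : ∫ x : ℝ, √d • act (C k) (x ^ j • φ (tagSign σ * (d * x - k))) =
      ((d : ℝ) ^ j)⁻¹ • ∑ l ∈ Finset.range (j + 1),
        (j.choose l * tagSign σ ^ l) • (1 / √d * (k : ℝ) ^ (j - l)) • act (C k) (moment φ l) := by
    simp only [← actL_apply]
    rw [integral_smul, (actL 𝕜 (C k)).integral_comp_comm (hφ.integrable_pow_smul_comp hd j σ k),
      hφ.integral_pow_smul_comp hd, map_smul, map_sum, smul_smul, hsqrt, mul_smul,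
      Finset.smul_sum]
    congr 1
    refine Finset.sum_congr rfl fun l _ => ?_
    rw [map_smul, smul_smul, smul_smul]
    ring_nf
  simp only [hterm]
  exact (hasSum_sum fun l _ =>
    (hasSum_discreteMoment (hC (j - l) (Nat.sub_le j l)) _).const_smul _).const_smul _

end Side

variable {C : Bool → ℤ → Matrix (Fin r) (Fin r) ℝ}

theorem Recursion.hasSum_pow_smul (hf : Recursion d (C true) (C false) φ f) (j : ℕ) (x : ℝ) :
    HasSum (fun k : ℤ => √d • act (C true k) (x ^ j • φ (tagSign true * (d * x - k))) +
      √d • act (C false k) (x ^ j • φ (tagSign false * (d * x - k)))) (x ^ j • f x) := by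
  convert (hf x).const_smul (x ^ j) using 2 with k
  simp only [← actL_apply, map_smul, tagSign, if_true, Bool.false_eq_true, if_false, one_mul,
    neg_one_mul, neg_sub, smul_add, smul_comm √(d : ℝ)]

theorem Recursion.moment_eq (hf : Recursion d (C true) (C false) φ f) (hφ : IsWindow R B φ)
    (hd : d ≠ 0) (horth : TwoDirection.Orthogonal φ) {j : ℕ}
    (hint : Integrable fun x => x ^ j • f x) :
    moment f j = ((d : ℝ) ^ j)⁻¹ •
      ∑ l ∈ Finset.range (j + 1), sepTerm d (C true) (C false) j l (moment φ l) := by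
  have hC (σ : Bool) (i : ℕ) (hi : i ≤ j) : Summable fun k : ℤ => (k : ℝ) ^ i • C σ k :=
    hf.summable_pow_smul_coeff hφ hd horth hi hint σ
  have hC₀ (σ : Bool) : Summable (C σ) := by
    simpa only [pow_zero, one_smul] using hC σ 0 (Nat.zero_le j)
  set F : Bool → ℤ → ℝ → Fin r → 𝕜 :=
    fun σ k x => √d • act (C σ k) (x ^ j • φ (tagSign σ * (d * x - k)))
  have hFint (σ : Bool) (k : ℤ) : Integrable (F σ k) :=
    ((actL 𝕜 (C σ k)).integrable_comp (hφ.integrable_pow_smul_comp hd j σ k)).smul √d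
  have hFnorm (σ : Bool) : Summable fun k => ∫ x, ‖F σ k x‖ :=
    hφ.summable_integral_norm_act hd (hC₀ σ) (hC σ j le_rfl) σ
  have hinterchange : HasSum (fun k => ∫ x, (F true k x + F false k x)) (moment f j) := by
    have hsum := hasSum_integral_of_summable_integral_norm
      (fun k => (hFint true k).add (hFint false k)) <|
      Summable.of_nonneg_of_le (fun k => integral_nonneg fun _ => norm_nonneg _)
        (fun k => (integral_mono ((hFint true k).add (hFint false k)).norm
          ((hFint true k).norm.add (hFint false k).norm) fun x => norm_add_le _ _).trans_eq
            (integral_add (hFint true k).norm (hFint false k).norm))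
        ((hFnorm true).add (hFnorm false))
    have hpt (x : ℝ) : ∑' k, (F true k x + F false k x) = x ^ j • f x :=
      (hf.hasSum_pow_smul j x).tsum_eq
    simp only [Pi.add_apply, hpt] at hsum
    exact hsum
  simp only [fun k => integral_add (hFint true k) (hFint false k)] at hinterchange
  rw [hinterchange.unique
    ((hφ.hasSum_integral_act hd (hC true) true).add (hφ.hasSum_integral_act hd (hC false) false)),
    ← smul_add, ← Finset.sum_add_distrib]
  simp only [sepTerm, tagSign, if_true, Bool.false_eq_true, if_false, one_pow, mul_one,
    ← actL_apply, map_add, map_smul, add_apply, smul_apply, mul_smul, smul_add]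

end Moments

section Projection

theorem norm_sq_starProjection_of_inner_eq_zero {E ι : Type*} [NormedAddCommGroup E]
    [InnerProductSpace 𝕜 E] {e : ι → E} (he : Orthonormal 𝕜 e) {K : Submodule 𝕜 E}
    [K.HasOrthogonalProjection] (hK : K = (Submodule.span 𝕜 (Set.range e)).topologicalClosure)
    (f : E) {S : Finset ι} (hS : ∀ p ∉ S, inner 𝕜 (e p) f = 0) :
    ‖K.starProjection f‖ ^ 2 = ∑ p ∈ S, ‖inner 𝕜 (e p) f‖ ^ 2 := by
  classical
  set g := ∑ p ∈ S, inner 𝕜 (e p) f • e p with hg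
  have hgK : g ∈ K := hK ▸ Submodule.le_topologicalClosure _ (Submodule.sum_mem _ fun p _ =>
    Submodule.smul_mem _ _ (Submodule.subset_span ⟨p, rfl⟩))
  have horth (p : ι) : inner 𝕜 (e p) (f - g) = 0 := by
    rw [inner_sub_right]
    by_cases hp : p ∈ S
    · rw [hg, he.inner_right_sum _ hp, sub_self]
    · rw [hS p hp, hg, inner_sum, zero_sub, neg_eq_zero]
      refine Finset.sum_eq_zero fun q hq => ?_
      rw [inner_smul_right, he.2 (ne_of_mem_of_not_mem hq hp).symm, mul_zero]
  have hfg : f - g ∈ Kᗮ := by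
    rw [hK, Submodule.orthogonal_closure, Submodule.mem_orthogonal]
    intro u hu
    refine Submodule.span_induction ?_ (inner_zero_left _) ?_ ?_ hu
    · rintro _ ⟨p, rfl⟩
      exact horth p
    · intro u v _ _ hu hv
      rw [inner_add_left, hu, hv, add_zero]
    · intro c u _ hu
      rw [inner_smul_left, hu, mul_zero]
  rw [Submodule.eq_starProjection_of_mem_orthogonal hgK hfg]
  apply (algebraMap ℝ 𝕜).injective
  have hinner := he.inner_sum (fun p => inner 𝕜 (e p) f) (fun p => inner 𝕜 (e p) f) S
  rw [← hg, inner_self_eq_norm_sq_to_K] at hinner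
  simpa only [map_pow, map_sum, RCLike.conj_mul] using hinner

end Projection

section ScaleSpace

variable {d : ℕ} {φ : ℝ → Fin r → 𝕜} {R : ℕ} {B : ℝ}

/-- The functions `d^{n/2} φ_i(dⁿ x - k)` and `d^{n/2} φ_i(k - dⁿ x)` as elements of `L²(ℝ)`. -/
noncomputable def normalizedShift (hφ : IsWindow R B φ) (hd : d ≠ 0) (n : ℤ)
    (p : Fin r × ℤ × Bool) : Lp 𝕜 2 (volume : Measure ℝ) :=
  algebraMap ℝ 𝕜 √((d : ℝ) ^ n) • (memLp_shift hφ hd n p).toLp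

theorem sqrt_zpow_ne_zero (hd : d ≠ 0) (n : ℤ) : √((d : ℝ) ^ n) ≠ 0 :=
  (Real.sqrt_pos.2 (zpow_pos (Nat.cast_pos.2 (Nat.pos_of_ne_zero hd)) n)).ne'

theorem orthonormal_normalizedShift (hφ : IsWindow R B φ) (hd : d ≠ 0)
    (horth : TwoDirection.Orthogonal φ) (n : ℤ) : Orthonormal 𝕜 (normalizedShift hφ hd n) := by
  classical
  have hinner (p q : Fin r × ℤ × Bool) :
      inner 𝕜 (memLp_shift hφ hd n p).toLp (memLp_shift hφ hd n q).toLp =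
        if p = q then algebraMap ℝ 𝕜 ((d : ℝ) ^ n)⁻¹ else 0 := by
    simp only [eq_comm (a := p)]
    rw [← integral_shift_mul_star horth, L2.inner_def]
    refine integral_congr_ae ?_
    filter_upwards [(memLp_shift hφ hd n p).coeFn_toLp, (memLp_shift hφ hd n q).coeFn_toLp]
      with x hp hq
    rw [hp, hq, RCLike.inner_apply, starRingEnd_apply]
  refine orthonormal_iff_ite.2 fun p q => ?_
  rw [normalizedShift, normalizedShift, inner_smul_left, inner_smul_right, hinner]
  split_ifs
  · have hdn : (0 : ℝ) ≤ (d : ℝ) ^ n := by positivity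
    rw [RCLike.algebraMap_eq_ofReal, RCLike.conj_ofReal, ← mul_assoc, ← RCLike.ofReal_mul,
      ← RCLike.ofReal_mul, Real.mul_self_sqrt hdn, mul_inv_cancel₀, RCLike.ofReal_one]
    exact zpow_ne_zero n (Nat.cast_ne_zero.2 hd)
  · rw [mul_zero, mul_zero]

open scoped Pointwise in
theorem scaleSpace_eq_closure_span (hφ : IsWindow R B φ) (hd : d ≠ 0) (n : ℤ) :
    scaleSpace d φ n =
      (Submodule.span 𝕜 (Set.range (normalizedShift hφ hd n))).topologicalClosure := by
  have hset : {f : Lp 𝕜 2 (volume : Measure ℝ) | ∃ p, f =ᵐ[volume] shift d φ n p} =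
      Set.range fun p => (memLp_shift hφ hd n p).toLp := by
    ext f
    refine exists_congr fun p => ⟨fun h => ?_, fun h => ?_⟩
    · exact (Lp.ext (h.trans (memLp_shift hφ hd n p).coeFn_toLp.symm)).symm
    · exact h ▸ (memLp_shift hφ hd n p).coeFn_toLp
  have hsmul : Set.range (normalizedShift hφ hd n) =
      algebraMap ℝ 𝕜 √((d : ℝ) ^ n) • Set.range fun p => (memLp_shift hφ hd n p).toLp :=
    Set.range_smul _ _
  rw [scaleSpace, hset, hsmul, Submodule.span_smul_eq_of_isUnit]
  exact ((map_ne_zero _).2 (sqrt_zpow_ne_zero hd n)).isUnit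

theorem norm_inner_normalizedShift_indicator (hφ : IsWindow R B φ) (hd : d ≠ 0) (n : ℤ)
    (p : Fin r × ℤ × Bool) {s : Set ℝ} (hs : MeasurableSet s) (hμs : volume s ≠ ⊤) :
    ‖inner 𝕜 (normalizedShift hφ hd n p) (indicatorConstLp 2 hs hμs 1)‖ ^ 2 =
      (d : ℝ) ^ n * ‖∫ x in s, shift d φ n p x‖ ^ 2 := by
  rw [norm_inner_symm, normalizedShift, inner_smul_right, L2.inner_indicatorConstLp_one,
    setIntegral_congr_ae hs ((memLp_shift hφ hd n p).coeFn_toLp.mono fun x hx _ => hx), norm_mul,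
    mul_pow, norm_algebraMap', Real.norm_of_nonneg (Real.sqrt_nonneg _),
    Real.sq_sqrt (by positivity)]

end ScaleSpace

section UnitInterval

variable {E : Type*} [NormedAddCommGroup E] [NormedSpace ℝ E] {R : ℕ} {B : ℝ} {g : ℝ → E}
  {D : ℕ} {k : ℤ}

namespace IsWindow

theorem setIntegral_comp_of_inner (hg : IsWindow R B g) (hD : D ≠ 0) (hk : (R : ℤ) ≤ k)
    (hkD : k ≤ D - R) :
    ∫ x in Set.Icc (0 : ℝ) 1, g (D * x - k) = (D : ℝ)⁻¹ • ∫ y, g y := by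
  rw [← integral_comp_natCast_mul_sub g D k]
  refine setIntegral_eq_integral_of_forall_compl_eq_zero fun x hx => hg.eq_zero _ ?_
  have hk' : (R : ℝ) ≤ k := by exact_mod_cast hk
  have hkD' : (k : ℝ) ≤ D - R := by exact_mod_cast hkD
  have hD : (0 : ℝ) < D := Nat.cast_pos.2 (Nat.pos_of_ne_zero hD)
  rw [lt_abs]
  rcases lt_or_ge x 0 with hx₀ | hx₀
  · exact .inr (by linarith [mul_neg_of_pos_of_neg hD hx₀])
  · have hx₁ : 1 < x := not_le.1 fun h => hx ⟨hx₀, h⟩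
    exact .inl (by linarith [lt_mul_of_one_lt_right hD hx₁])

theorem setIntegral_comp_of_outer (hg : IsWindow R B g)
    (hk : k ∉ Finset.Icc (-R : ℤ) (D + R)) :
    ∫ x in Set.Icc (0 : ℝ) 1, g (D * x - k) = 0 := by
  refine setIntegral_eq_zero_of_forall_eq_zero fun x hx => hg.eq_zero _ ?_
  have hD : (0 : ℝ) ≤ D := D.cast_nonneg
  rw [Finset.mem_Icc, not_and_or, not_le, not_le] at hk
  rw [lt_abs]
  rcases hk with hk | hk
  · have hk' : (k : ℝ) < -R := by exact_mod_cast hk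
    exact .inl (by linarith [mul_nonneg hD hx.1])
  · have hk' : (D : ℝ) + R < k := by exact_mod_cast hk
    exact .inr (by linarith [mul_le_of_le_one_right hD hx.2])

theorem norm_setIntegral_comp_le (hg : IsWindow R B g) (hD : D ≠ 0) (k : ℤ) :
    ‖∫ x in Set.Icc (0 : ℝ) 1, g (D * x - k)‖ ≤ (D : ℝ)⁻¹ * ∫ y, ‖g y‖ := by
  have hint : Integrable fun x : ℝ => g (D * x - k) :=
    (hg.integrable.comp_sub_right (k : ℝ)).comp_mul_left' (Nat.cast_ne_zero.2 hD)
  calc ‖∫ x in Set.Icc (0 : ℝ) 1, g (D * x - k)‖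
      ≤ ∫ x in Set.Icc (0 : ℝ) 1, ‖g (D * x - k)‖ := norm_integral_le_integral_norm _
    _ ≤ ∫ x : ℝ, ‖g (D * x - k)‖ :=
        setIntegral_le_integral hint.norm (Filter.Eventually.of_forall fun _ => norm_nonneg _)
    _ = (D : ℝ)⁻¹ * ∫ y, ‖g y‖ := integral_comp_natCast_mul_sub (fun y => ‖g y‖) D k

theorem abs_mul_sq_setIntegral_sub_le (hg : IsWindow R B g) (hD : D ≠ 0)
    (hk : k ∈ Finset.Icc (-R : ℤ) (D + R)) :
    |D * ‖∫ x in Set.Icc (0 : ℝ) 1, g (D * x - k)‖ ^ 2 - (D : ℝ)⁻¹ * ‖∫ y, g y‖ ^ 2| ≤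
      if k ∈ Finset.Icc (-R : ℤ) R ∪ Finset.Icc (D - R : ℤ) (D + R) then
        (D : ℝ)⁻¹ * (∫ y, ‖g y‖) ^ 2 else 0 := by
  have hD' : (D : ℝ) ≠ 0 := Nat.cast_ne_zero.2 hD
  have hscale (t : ℝ) : D * ((D : ℝ)⁻¹ * t) ^ 2 = (D : ℝ)⁻¹ * t ^ 2 := by field_simp
  split_ifs with hkZ
  · refine abs_sub_le_of_nonneg_of_le (by positivity) ?_ (by positivity) ?_
    · rw [← hscale]
      gcongr
      exact hg.norm_setIntegral_comp_le hD k
    · gcongr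
      exact norm_integral_le_integral_norm g
  · rw [Finset.mem_union, Finset.mem_Icc, Finset.mem_Icc] at hkZ
    rw [Finset.mem_Icc] at hk
    rw [hg.setIntegral_comp_of_inner hD (by omega) (by omega), norm_smul, norm_inv,
      Real.norm_natCast, hscale, sub_self, abs_zero]

theorem abs_sum_mul_sq_setIntegral_sub_le (hg : IsWindow R B g) (hD : D ≠ 0) :
    |(∑ k ∈ Finset.Icc (-R : ℤ) (D + R), D * ‖∫ x in Set.Icc (0 : ℝ) 1, g (D * x - k)‖ ^ 2) -
        (D + (2 * R + 1)) * ((D : ℝ)⁻¹ * ‖∫ y, g y‖ ^ 2)| ≤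
      (4 * R + 2) * ((D : ℝ)⁻¹ * (∫ y, ‖g y‖) ^ 2) := by
  set W := Finset.Icc (-R : ℤ) (D + R) with hW
  set Z := Finset.Icc (-R : ℤ) R ∪ Finset.Icc (D - R : ℤ) (D + R)
  have card_W : (W.card : ℝ) = D + (2 * R + 1) := by
    have : W.card = D + (2 * R + 1) := by
      rw [hW, Int.card_Icc]
      omega
    exact_mod_cast this
  have card_Z : (Z.card : ℝ) ≤ 4 * R + 2 := by
    have : Z.card ≤ 4 * R + 2 := by
      refine (Finset.card_union_le _ _).trans ?_
      rw [Int.card_Icc, Int.card_Icc]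
      omega
    exact_mod_cast this
  rw [← card_W, ← nsmul_eq_mul W.card, ← Finset.sum_const, ← Finset.sum_sub_distrib]
  calc _ ≤ ∑ k ∈ W, if k ∈ Z then (D : ℝ)⁻¹ * (∫ y, ‖g y‖) ^ 2 else 0 :=
        (Finset.abs_sum_le_sum_abs _ _).trans <|
          Finset.sum_le_sum fun _ hk => hg.abs_mul_sq_setIntegral_sub_le hD hk
    _ = ∑ k ∈ W with k ∈ Z, (D : ℝ)⁻¹ * (∫ y, ‖g y‖) ^ 2 := (Finset.sum_filter _ _).symm
    _ ≤ ∑ _ ∈ Z, (D : ℝ)⁻¹ * (∫ y, ‖g y‖) ^ 2 :=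
        Finset.sum_le_sum_of_subset_of_nonneg (fun _ hk => (Finset.mem_filter.1 hk).2)
          fun _ _ _ => by positivity
    _ = Z.card * ((D : ℝ)⁻¹ * (∫ y, ‖g y‖) ^ 2) := by rw [Finset.sum_const, nsmul_eq_mul]
    _ ≤ (4 * R + 2) * ((D : ℝ)⁻¹ * (∫ y, ‖g y‖) ^ 2) := by gcongr

open Filter Topology in
theorem tendsto_sum_mul_sq_setIntegral (hg : IsWindow R B g) :
    Tendsto (fun D : ℕ => ∑ k ∈ Finset.Icc (-R : ℤ) (D + R),
        D * ‖∫ x in Set.Icc (0 : ℝ) 1, g (D * x - k)‖ ^ 2)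
      atTop (𝓝 (‖∫ y, g y‖ ^ 2)) := by
  have hinv : Tendsto (fun D : ℕ => (D : ℝ)⁻¹) atTop (𝓝 0) := tendsto_inv_atTop_nhds_zero_nat
  have hmain : Tendsto (fun D : ℕ => (D + (2 * R + 1)) * ((D : ℝ)⁻¹ * ‖∫ y, g y‖ ^ 2)) atTop
      (𝓝 (‖∫ y, g y‖ ^ 2)) := by
    have h := ((hinv.const_mul (2 * (R : ℝ) + 1)).const_add 1).mul_const (‖∫ y, g y‖ ^ 2)
    rw [mul_zero, add_zero, one_mul] at h
    refine h.congr' ((eventually_ne_atTop 0).mono fun D hD => ?_)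
    have hD' : (D : ℝ) ≠ 0 := Nat.cast_ne_zero.2 hD
    field_simp
  have herr : Tendsto (fun D : ℕ => (4 * (R : ℝ) + 2) * ((D : ℝ)⁻¹ * (∫ y, ‖g y‖) ^ 2)) atTop
      (𝓝 0) := by
    simpa only [zero_mul, mul_zero] using
      (hinv.mul_const ((∫ y, ‖g y‖) ^ 2)).const_mul (4 * (R : ℝ) + 2)
  refine tendsto_of_tendsto_of_dist hmain (squeeze_zero' (Eventually.of_forall fun _ =>
    dist_nonneg) ((eventually_ne_atTop 0).mono fun D hD => ?_) herr)
  rw [dist_comm, Real.dist_eq]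
  exact hg.abs_sum_mul_sq_setIntegral_sub_le hD

end IsWindow

end UnitInterval

section Normalization

variable {d : ℕ} {φ : ℝ → Fin r → 𝕜} {R : ℕ} {B : ℝ}

theorem moment_zero_apply (hφ : Integrable φ) (b : Fin r) : moment φ 0 b = ∫ x, φ x b := by
  simp only [moment, pow_zero, one_smul]
  exact eval_integral (fun i => hφ.eval i) b

theorem shift_natCast_eq (n : ℕ) (b : Fin r) (k : ℤ) (σ : Bool) (x : ℝ) :
    shift d φ n (b, k, σ) x = φ (tagSign σ * ((d ^ n : ℕ) * x - k)) b := by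
  rw [shift_apply, zpow_natCast, Nat.cast_pow]

open Filter Topology in
theorem tendsto_sum_setIntegral_shift (hφ : IsWindow R B φ) (hd : 2 ≤ d) (b : Fin r) (σ : Bool) :
    Tendsto (fun n : ℕ => ∑ k ∈ Finset.Icc (-R : ℤ) ((d ^ n : ℕ) + R),
        (d : ℝ) ^ (n : ℤ) * ‖∫ x in Set.Icc (0 : ℝ) 1, shift d φ n (b, k, σ) x‖ ^ 2)
      atTop (𝓝 (‖moment φ 0 b‖ ^ 2)) := by
  have h := ((hφ.apply b).comp_tagSign σ).tendsto_sum_mul_sq_setIntegral.comp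
    (tendsto_pow_atTop_atTop_of_one_lt (Nat.lt_of_succ_le hd))
  rw [integral_comp_tagSign_mul (fun y => φ y b), ← moment_zero_apply hφ.integrable] at h
  refine h.congr fun n => ?_
  simp only [Function.comp_apply, shift_natCast_eq, zpow_natCast, Nat.cast_pow]

theorem norm_sq_starProjection_scaleSpace (hφ : IsWindow R B φ) (hd : d ≠ 0)
    (horth : TwoDirection.Orthogonal φ) (n : ℕ) [(scaleSpace d φ n).HasOrthogonalProjection] :
    ‖(scaleSpace d φ n).starProjection
        (indicatorConstLp 2 (measurableSet_Icc (a := (0 : ℝ)) (b := 1)) (by simp) 1)‖ ^ 2 =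
      ∑ b, ∑ σ, ∑ k ∈ Finset.Icc (-R : ℤ) ((d ^ n : ℕ) + R),
        (d : ℝ) ^ (n : ℤ) * ‖∫ x in Set.Icc (0 : ℝ) 1, shift d φ n (b, k, σ) x‖ ^ 2 := by
  rw [norm_sq_starProjection_of_inner_eq_zero (orthonormal_normalizedShift hφ hd horth n)
    (scaleSpace_eq_closure_span hφ hd n)
    (S := Finset.univ ×ˢ (Finset.Icc (-R : ℤ) ((d ^ n : ℕ) + R) ×ˢ Finset.univ))]
  · rw [Finset.sum_product]
    refine Finset.sum_congr rfl fun b _ => ?_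
    rw [Finset.sum_product, Finset.sum_comm]
    simp only [norm_inner_normalizedShift_indicator]
  · rintro ⟨b, k, σ⟩ hp
    have hk : k ∉ Finset.Icc (-R : ℤ) ((d ^ n : ℕ) + R) := by simpa using hp
    rw [← norm_eq_zero, ← sq_eq_zero_iff, norm_inner_normalizedShift_indicator]
    simp only [shift_natCast_eq]
    rw [((hφ.apply b).comp_tagSign σ).setIntegral_comp_of_outer hk, norm_zero, sq, zero_mul,
      mul_zero]

open Filter Topology in
theorem sum_norm_sq_moment_zero (hφ : IsWindow R B φ) (hd : 2 ≤ d)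
    (horth : TwoDirection.Orthogonal φ) (hmra : IsMRA d (scaleSpace d φ)) :
    ∑ b, ‖moment φ 0 b‖ ^ 2 = 1 / 2 := by
  have (n : ℤ) : CompleteSpace (scaleSpace d φ n) := (hmra.closed n).completeSpace_coe
  set f : Lp 𝕜 2 (volume : Measure ℝ) :=
    indicatorConstLp 2 (measurableSet_Icc (a := (0 : ℝ)) (b := 1)) (by simp) 1 with hf
  have hnorm : ‖f‖ = 1 := by
    rw [hf, norm_indicatorConstLp two_ne_zero ENNReal.ofNat_ne_top]
    simp
  have hproj : Tendsto (fun n : ℕ => ‖(scaleSpace d φ n).starProjection f‖ ^ 2) atTop (𝓝 1) := by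
    have h := Submodule.starProjection_tendsto_self (scaleSpace d φ)
      (monotone_int_of_le_succ hmra.nested) f hmra.dense.ge
    simpa only [hnorm, one_pow, Function.comp_apply] using
      (h.comp (tendsto_natCast_atTop_atTop (R := ℤ))).norm.pow 2
  have hsum : Tendsto (fun n : ℕ => ‖(scaleSpace d φ n).starProjection f‖ ^ 2) atTop
      (𝓝 (∑ b, ∑ _σ : Bool, ‖moment φ 0 b‖ ^ 2)) := by
    simp only [hf, norm_sq_starProjection_scaleSpace hφ (two_pos.trans_le hd).ne' horth]
    exact tendsto_finsetSum _ fun b _ => tendsto_finsetSum _ fun σ _ =>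
      tendsto_sum_setIntegral_shift hφ hd b σ
  have hone := tendsto_nhds_unique hsum hproj
  simp only [Fintype.sum_bool, ← two_mul, ← Finset.mul_sum] at hone
  linarith

end Normalization

section MomentRecursion

variable {d : ℕ} {φ : ℝ → Fin r → 𝕜} {C : Bool → ℤ → Matrix (Fin r) (Fin r) ℝ} {R : ℕ} {B : ℝ}

theorem star_dotProduct_self (v : Fin r → 𝕜) :
    star v ⬝ᵥ v = algebraMap ℝ 𝕜 (∑ b, ‖v b‖ ^ 2) := by
  rw [dotProduct, map_sum]
  refine Finset.sum_congr rfl fun b _ => ?_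
  rw [Pi.star_apply, ← starRingEnd_apply, RCLike.conj_mul, map_pow]

theorem star_moment_zero_dotProduct_self (hφ : IsWindow R B φ) (hd : 2 ≤ d)
    (horth : TwoDirection.Orthogonal φ) (hmra : IsMRA d (scaleSpace d φ)) :
    star (moment φ 0) ⬝ᵥ moment φ 0 = 1 / 2 := by
  rw [star_dotProduct_self, sum_norm_sq_moment_zero hφ hd horth hmra, map_div₀, map_one,
    map_ofNat]

theorem norm_eq_one_of_star_dotProduct_smul_self {c : 𝕜} {w : Fin r → 𝕜}
    (h : star (c • w) ⬝ᵥ (c • w) = star w ⬝ᵥ w) (hw : star w ⬝ᵥ w ≠ 0) : ‖c‖ = 1 := by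
  rw [star_smul, smul_dotProduct, dotProduct_smul, smul_smul, smul_eq_mul,
    mul_eq_right₀ hw, ← starRingEnd_apply, RCLike.conj_mul] at h
  exact (pow_eq_one_iff_of_nonneg (norm_nonneg c) two_ne_zero).1 (by exact_mod_cast h)

theorem exists_norm_eq_one_eq_smul_of_act_eq {A : Matrix (Fin r) (Fin r) ℝ}
    (hA : A.charpoly.rootMultiplicity 1 ≤ 1) {v w : Fin r → 𝕜} (hv : act A v = v)
    (hw : act A w = w) (hvw : star v ⬝ᵥ v = star w ⬝ᵥ w) (hw0 : star w ⬝ᵥ w ≠ 0) :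
    ∃ c : 𝕜, ‖c‖ = 1 ∧ v = c • w := by
  obtain ⟨c, rfl⟩ := exists_eq_smul_of_act_eq hA hv hw fun h => hw0 (by rw [h, dotProduct_zero])
  exact ⟨c, norm_eq_one_of_star_dotProduct_smul_self hvw hw0, rfl⟩

theorem Recursion.act_moment_zero (hrec : Recursion d (C true) (C false) φ φ)
    (hφ : IsWindow R B φ) (hd : d ≠ 0) (horth : TwoDirection.Orthogonal φ) :
    act (discreteMoment d (fun k => C true k + C false k) 0) (moment φ 0) = moment φ 0 := by
  have hint : Integrable fun x : ℝ => x ^ 0 • φ x := hφ.continuous_smul (continuous_pow 0)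
  have hC (σ : Bool) : Summable (C σ) := by
    simpa only [pow_zero, one_smul] using hrec.summable_pow_smul_coeff hφ hd horth le_rfl hint σ
  rw [discreteMoment_zero_add (hC true) (hC false)]
  simpa [sepTerm] using (hrec.moment_eq hφ hd horth hint).symm

theorem Recursion.act_sepMatrix_moment (hrec : Recursion d (C true) (C false) φ φ)
    (hφ : IsWindow R B φ) (hd : d ≠ 0) (horth : TwoDirection.Orthogonal φ) (j : ℕ) :
    act (sepMatrix d (C true) (C false) j) (moment φ j) =
      ∑ l ∈ Finset.range j, sepTerm d (C true) (C false) j l (moment φ l) := by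
  have h := hrec.moment_eq hφ hd horth (hφ.continuous_smul (continuous_pow j))
  rw [eq_inv_smul_iff₀ (pow_ne_zero j (Nat.cast_ne_zero.2 hd)), Finset.sum_range_succ,
    ← sub_eq_iff_eq_add, sepTerm, Nat.choose_self, Nat.cast_one, one_smul, Nat.sub_self] at h
  rw [sepMatrix, act_smul_one_sub, h]

theorem eq_act_inv_of_act_eq {A : Matrix (Fin r) (Fin r) ℝ} (hA : IsUnit A) {v w : Fin r → 𝕜}
    (h : act A v = w) : v = act A⁻¹ w := by
  rw [← h, ← act_mul, Matrix.nonsing_inv_mul _ ((Matrix.isUnit_iff_isUnit_det _).1 hA), act_one]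

theorem eq_of_moment_recursion {Cp Cm : ℤ → Matrix (Fin r) (Fin r) ℝ} {v w : ℕ → Fin r → 𝕜}
    (h0 : v 0 = w 0)
    (hv : ∀ j, 1 ≤ j →
      v j = act (sepMatrix d Cp Cm j)⁻¹ (∑ l ∈ Finset.range j, sepTerm d Cp Cm j l (v l)))
    (hw : ∀ j, 1 ≤ j →
      w j = act (sepMatrix d Cp Cm j)⁻¹ (∑ l ∈ Finset.range j, sepTerm d Cp Cm j l (w l))) :
    v = w := by
  funext j
  induction j using Nat.strong_induction_on with
  | _ j ih =>
    rcases Nat.eq_zero_or_pos j with rfl | hj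
    · exact h0
    · rw [hv j hj, hw j hj]
      exact congrArg _ (Finset.sum_congr rfl fun l hl => by rw [ih l (Finset.mem_range.1 hl)])

theorem GeneratesMRA.aestronglyMeasurable (h : GeneratesMRA d φ) : AEStronglyMeasurable φ := by
  refine (aemeasurable_pi_iff.2 fun b => ?_).aestronglyMeasurable
  have hb := (h.2.1 (b, 0, true)).1.aemeasurable
  simpa only [funext (shift_apply _ _ _ _), zpow_zero, tagSign, if_true, Int.cast_zero, sub_zero,
    one_mul] using hb

end MomentRecursion

end TwoDirection

theorem theorem4p2_general {𝕜 ι : Type*} [RCLike 𝕜] {d r : ℕ} (hd : 2 ≤ d)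
    (Pp Pm : ℤ → Matrix (Fin r) (Fin r) ℝ) (φ : ℝ → Fin r → 𝕜)
    (hφ : IsMultiscaling d Pp Pm φ) (horth : TwoDirection.Orthogonal φ)
    (hsupp : HasCompactSupport φ) (hbdd : Bornology.IsBounded (Set.range φ))
    (hE : ConditionE ((doubledMask d Pp Pm).map (algebraMap ℝ ℂ)))
    (Qp Qm : ι → ℤ → Matrix (Fin r) (Fin r) ℝ) (ψ : ι → ℝ → Fin r → 𝕜)
    (hψ : ∀ s, Recursion d (Qp s) (Qm s) φ (ψ s)) :
    ((Function.support Pp).Finite ∧ (Function.support Pm).Finite ∧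
      ∀ j : ℕ, Integrable (fun x : ℝ => (x ^ j) • φ x)) ∧
    (act (discreteMoment d (fun k => Pp k + Pm k) 0) (moment φ 0) = moment φ 0 ∧
      star (moment φ 0) ⬝ᵥ moment φ 0 = 1 / 2 ∧
      ∀ v : Fin r → 𝕜, act (discreteMoment d (fun k => Pp k + Pm k) 0) v = v →
        star v ⬝ᵥ v = 1 / 2 → ∃ c : 𝕜, ‖c‖ = 1 ∧ v = c • moment φ 0) ∧
    (∀ j : ℕ, 1 ≤ j →
      IsUnit (sepMatrix d Pp Pm j) ∧
      moment φ j =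
        act (sepMatrix d Pp Pm j)⁻¹ (∑ l ∈ Finset.range j, sepTerm d Pp Pm j l (moment φ l))) ∧
    (∀ v : ℕ → Fin r → 𝕜, v 0 = moment φ 0 →
      (∀ j : ℕ, 1 ≤ j →
        v j = act (sepMatrix d Pp Pm j)⁻¹ (∑ l ∈ Finset.range j, sepTerm d Pp Pm j l (v l))) →
      v = moment φ) ∧
    (∀ (s : ι) (j : ℕ), Integrable (fun x : ℝ => (x ^ j) • ψ s x) →
      (∀ i ≤ j, Summable (fun k : ℤ => (k : ℝ) ^ i • Qp s k) ∧
        Summable (fun k : ℤ => (k : ℝ) ^ i • Qm s k)) ∧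
      moment (ψ s) j =
        ((d : ℝ) ^ j)⁻¹ •
          ∑ l ∈ Finset.range (j + 1), sepTerm d (Qp s) (Qm s) j l (moment φ l)) := by
  obtain ⟨R, B, hwin⟩ := exists_isWindow hφ.mra.aestronglyMeasurable hbdd hsupp
  have hd0 : d ≠ 0 := (two_pos.trans_le hd).ne'
  let P (σ : Bool) : ℤ → Matrix (Fin r) (Fin r) ℝ := cond σ Pp Pm
  have hrec : Recursion d (P true) (P false) φ φ := hφ.recursion
  have hfin (σ : Bool) : (Function.support (P σ)).Finite :=
    hrec.finite_support hwin hd0 horth hsupp σ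
  have hsum (σ : Bool) : Summable (P σ) := summable_of_hasFiniteSupport (hfin σ)
  have hfix := hrec.act_moment_zero hwin hd0 horth
  have hnorm := star_moment_zero_dotProduct_self hwin hd horth hφ.mra.1
  have hmult := rootMultiplicity_discreteMoment_add_le_one (hsum true) (hsum false) hE
  have hmom (j : ℕ) (hj : 1 ≤ j) :=
    have hunit := isUnit_sepMatrix hd (hsum true) (hsum false) hE hj
    And.intro hunit (eq_act_inv_of_act_eq hunit (hrec.act_sepMatrix_moment hwin hd0 horth j))
  refine ⟨⟨hfin true, hfin false, fun j => hwin.continuous_smul (continuous_pow j)⟩,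
    ⟨hfix, hnorm, fun v hv hv1 => ?_⟩, hmom, fun v h0 hv => ?_, fun s j hj => ?_⟩
  · exact exists_norm_eq_one_eq_smul_of_act_eq hmult hv hfix (hv1.trans hnorm.symm)
      (by rw [hnorm]; norm_num)
  · exact eq_of_moment_recursion h0 hv fun j hj => (hmom j hj).2
  · let Q (σ : Bool) : ℤ → Matrix (Fin r) (Fin r) ℝ := cond σ (Qp s) (Qm s)
    have hrecψ : Recursion d (Q true) (Q false) φ (ψ s) := hψ s
    have hsummable {i : ℕ} (hi : i ≤ j) := hrecψ.summable_pow_smul_coeff hwin hd0 horth hi hj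
    exact ⟨fun i hi => ⟨hsummable hi true, hsummable hi false⟩,
      hrecψ.moment_eq hwin hd0 horth hj⟩

theorem theorem4p2 {𝕜 : Type*} [RCLike 𝕜] {d r : ℕ} (hd : 2 ≤ d)
    (Pp Pm : ℤ → Matrix (Fin r) (Fin r) ℝ) (φ : ℝ → Fin r → 𝕜)
    (hφ : IsMultiscaling d Pp Pm φ) (horth : TwoDirection.Orthogonal φ)
    (hsupp : HasCompactSupport φ) (hcont : Continuous φ)
    (hE : ConditionE ((doubledMask d Pp Pm).map (algebraMap ℝ ℂ)))
    (Qp Qm : Fin (d - 1) → ℤ → Matrix (Fin r) (Fin r) ℝ) (ψ : Fin (d - 1) → ℝ → Fin r → 𝕜)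
    (hψ : ∀ s, Recursion d (Qp s) (Qm s) φ (ψ s)) :
    -- the sums and integrals that define the moments of `φ` make sense
    ((Function.support Pp).Finite ∧ (Function.support Pm).Finite ∧
      ∀ j : ℕ, Integrable (fun x : ℝ => (x ^ j) • φ x)) ∧
    -- `m_0` is the eigenvector of `M_0` for the eigenvalue `1`, normalized by `m_0^* m_0 = 1/2`
    (act (discreteMoment d (fun k => Pp k + Pm k) 0) (moment φ 0) = moment φ 0 ∧
      star (moment φ 0) ⬝ᵥ moment φ 0 = 1 / 2 ∧
      ∀ v : Fin r → 𝕜, act (discreteMoment d (fun k => Pp k + Pm k) 0) v = v →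
        star v ⬝ᵥ v = 1 / 2 → ∃ c : 𝕜, ‖c‖ = 1 ∧ v = c • moment φ 0) ∧
    -- the recursion for the higher moments of `φ`
    (∀ j : ℕ, 1 ≤ j →
      IsUnit (sepMatrix d Pp Pm j) ∧
      moment φ j =
        act (sepMatrix d Pp Pm j)⁻¹ (∑ l ∈ Finset.range j, sepTerm d Pp Pm j l (moment φ l))) ∧
    -- all moments are determined by `m_0` and the recursion
    (∀ v : ℕ → Fin r → 𝕜, v 0 = moment φ 0 →
      (∀ j : ℕ, 1 ≤ j →
        v j = act (sepMatrix d Pp Pm j)⁻¹ (∑ l ∈ Finset.range j, sepTerm d Pp Pm j l (v l))) →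
      v = moment φ) ∧
    -- the moments of the multiwavelets, whenever they exist
    (∀ (s : Fin (d - 1)) (j : ℕ), Integrable (fun x : ℝ => (x ^ j) • ψ s x) →
      (∀ i ≤ j, Summable (fun k : ℤ => (k : ℝ) ^ i • Qp s k) ∧
        Summable (fun k : ℤ => (k : ℝ) ^ i • Qm s k)) ∧
      moment (ψ s) j =
        ((d : ℝ) ^ j)⁻¹ •
          ∑ l ∈ Finset.range (j + 1), sepTerm d (Qp s) (Qm s) j l (moment φ l)) := by
  exact theorem4p2_general hd Pp Pm φ hφ horth hsupp (hsupp.isCompact_range hcont).isBounded hE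
    Qp Qm ψ hψ
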